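/- **Elementary gates and circuits.** Elementary gates are arbitrary one-qubit unitaries and controlled-not gates between two distinct qubits. A circuit on $n$ data qubits and any number of ancilla qubits *implements* a map $V$ on signals of length $\ell\le 2^n$ if, for every $x\in\mathbf{C}^\ell$, it sends $\sum_m x_m|m\rangle\otimes|0\cdots0\rangle$ to $\sum_m (Vx)_m|m\rangle\otimes|0\cdots 0\rangle$; its cost is its number of gates. **Splitting steps.** On $\ell^2(\mathbf{Z}/2N\mathbf{Z})$ let $T_s e_m=e_{m+s}$ be the translation operators, and call the operators $I_N\otimes U$, $U$ a unitary $2\times 2$ matrix, local rotation operators. $(\alpha,\beta)$ is a QMF system if $f_{2k}=T_{2k}\alpha$, $f_{2k+1}=T_{2k}\beta$ ($0\le k<N$) form an orthonormal basis; its splitting step $\mathrm{SPLIT}$ is the adjoint of the matrix with columns $f_0,\dots,f_{2N-1}$. **Transforms.** Consider signals of length $M2^k$, $M\ge 1$, with $M2^k\le 2^n$ (for instance $M2^k=2^n$). For each level $j=0,\dots,k-1$ let a QMF system of $\ell^2(\mathbf{Z}/M2^{k-j}\mathbf{Z})$ be given, with splitting step $\mathrm{SPLIT}_j$. Level $j$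 of the periodized wavelet packet transform applies $\mathrm{SPLIT}_j$ to each of the $2^j$ subsequences $(x_{2^ji+r})_i$, $0\le r<2^j$, i.e. it is $\mathrm{SPLIT}_j\otimes I_{2^j}$; level $j$ of the periodized wavelet transform (the conditioned splitting step) applies it only to the subsequence $r=0$ and leaves the other coefficients unchanged. Each transform is the composition of its levels $0,1,\dots,k-1$. **Theorem.** There is an absolute constant $C$ such that, whenever each $\mathrm{SPLIT}_j$ is a product of $L$ local rotation and translation operators, the following hold. 1. There are $k\le n$ levels, and each level of the wavelet transform, and each level of the wavelet packet transform, is implemented with at most $C\,L\,n$ elementary gates. 2. The wavelet transform and the wavelet packet transform are each implemented with at most $C\,L\,n^2$ elementary gates. 3. The packet transform needs no conditioning: if, for each $j$, $Q_j$ is any circuit on $n-j$ data qubits that implements $\mathrm{SPLIT}_j$, then the wavelet packet transform is implemented with exactly $\sum_j|Q_j|$ gates. 4. Conditioning never saves gates: if a circuit $W$ implements the conditioned splitting step of level $j$, then some circuit $Q$ on $n-j$ data qubits implements $\mathrm{SPLIT}_j$ with $|Q|\le|W|$, and $|Q|<|W|$ if $j\ge1$ and $\mathrm{SPLIT}_j$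 is a single local rotation $I\otimes U$ with $U$ not a scalar matrix. Consequently, if $W_0,\dots,W_{k-1}$ are any circuits implementing the conditioned splitting steps of the wavelet transform, the wavelet packet transform is implemented with at most $\sum_j|W_j|$ gates, and with strictly fewer if some $\mathrm{SPLIT}_j$ with $j\ge 1$ is such a rotation. -/

import Mathlib

open scoped Matrix Kronecker

/-! ### Quantum circuits -/

/-- Elementary gates on the qubits `Q`: an arbitrary unitary operation on one qubit, and the
controlled not gate with control `c` and target `t`. -/
inductive Gate (Q : Type) : Type
  | single (q : Q) (U : Matrix.unitaryGroup (Fin 2) ℂ) : Gate Q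
  | cnot (c t : Q) (h : c ≠ t) : Gate Q

/-- The matrix of an elementary gate with respect to the basis states `|b⟩`, `b : Q → Fin 2`. -/
noncomputable def Gate.toMatrix {Q : Type} [Fintype Q] [DecidableEq Q] :
    Gate Q → Matrix (Q → Fin 2) (Q → Fin 2) ℂ
  | .single q U => fun b b' => if ∀ p, p ≠ q → b p = b' p then U.1 (b q) (b' q) else 0
  | .cnot c t _ => fun b b' => if b = Function.update b' t (b' t + b' c) then 1 else 0

/-- A circuit with `n` data qubits and `a` ancilla qubits: a list of elementary gates, the head of
the list being applied first. Its cost is the length of the list. -/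
abbrev Circuit (n a : ℕ) : Type := List (Gate (Fin n ⊕ Fin a))

/-- The matrix of a circuit. -/
noncomputable def Circuit.toMatrix {n a : ℕ} :
    Circuit n a → Matrix (Fin n ⊕ Fin a → Fin 2) (Fin n ⊕ Fin a → Fin 2) ℂ
  | [] => 1
  | g :: c => Circuit.toMatrix c * g.toMatrix

/-- The number `∑ i, b i * 2 ^ i` held by the data qubits in the basis state `b`
(qubit `0` is the least significant one). -/
def dataValue {n a : ℕ} (b : Fin n ⊕ Fin a → Fin 2) : ℕ :=
  (finFunctionFinEquiv fun q : Fin n => b (Sum.inl q)).val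

/-- The register state `∑ m, x m |m⟩ ⊗ |0…0⟩` that represents the signal `x` of length `ℓ`
(used for `ℓ ≤ 2 ^ n`), all ancilla qubits being in the state `|0⟩`. -/
noncomputable def encode (n a : ℕ) {ℓ : ℕ} (x : Fin ℓ → ℂ) : (Fin n ⊕ Fin a → Fin 2) → ℂ :=
  fun b =>
    if h : dataValue b < ℓ ∧ ∀ q : Fin a, b (Sum.inr q) = 0 then x ⟨dataValue b, h.1⟩ else 0

/-- The circuit maps the state of every signal `x` to the state of `V x`; the ancilla qubits start
in `|0⟩` and are returned to `|0⟩`. -/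
def Circuit.Implements {n a ℓ : ℕ} (c : Circuit n a) (V : (Fin ℓ → ℂ) → (Fin ℓ → ℂ)) : Prop :=
  ∀ x : Fin ℓ → ℂ, c.toMatrix *ᵥ encode n a x = encode n a (V x)

/-! ### Splitting steps on `ℓ²(ℤ/2Nℤ)`; the arithmetic of `Fin (N * 2)` is that of `ℤ/2Nℤ` -/

/-- The translation operator: `T_s e_m = e_{m + s}`, as a matrix. -/
def translationOp {ℓ : ℕ} (s : Fin ℓ) : Matrix (Fin ℓ) (Fin ℓ) ℂ :=
  fun m i => if m = i + s then 1 else 0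

/-- The local rotation operator with matrix `I_N ⊗ U`. -/
noncomputable def localRotation (N : ℕ) (U : Matrix.unitaryGroup (Fin 2) ℂ) :
    Matrix (Fin (N * 2)) (Fin (N * 2)) ℂ :=
  Matrix.reindex finProdFinEquiv finProdFinEquiv ((1 : Matrix (Fin N) (Fin N) ℂ) ⊗ₖ U.1)

/-- Local rotation operators and translation operators. -/
def IsElementaryStep {N : ℕ} (A : Matrix (Fin (N * 2)) (Fin (N * 2)) ℂ) : Prop :=
  (∃ U : Matrix.unitaryGroup (Fin 2) ℂ, A = localRotation N U) ∨
    ∃ s : Fin (N * 2), A = translationOp s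

/-- The vectors `f_{2k} = T_{2k} α` and `f_{2k+1} = T_{2k} β` for `0 ≤ k < N`. -/
noncomputable def splitVector {N : ℕ} (α β : Fin (N * 2) → ℂ) (i : Fin (N * 2)) :
    EuclideanSpace ℂ (Fin (N * 2)) :=
  WithLp.toLp 2 (translationOp (⟨2 * (i.val / 2), by omega⟩ : Fin (N * 2)) *ᵥ
    if i.val % 2 = 0 then α else β)

/-- `(α, β)` is a QMF system: the vectors `T_{2k} α`, `T_{2k} β`, `0 ≤ k < N`, form an orthonormal
basis of `ℓ²(ℤ/2Nℤ)`. -/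
def IsQMF {N : ℕ} (α β : Fin (N * 2) → ℂ) : Prop :=
  Orthonormal ℂ (splitVector α β) ∧ Submodule.span ℂ (Set.range (splitVector α β)) = ⊤

/-- The splitting step of `(α, β)`: the adjoint of the base change matrix from `(e_i)` to `(f_i)`,
which has the `f_i` as its columns. -/
noncomputable def splitMatrix {N : ℕ} (α β : Fin (N * 2) → ℂ) :
    Matrix (Fin (N * 2)) (Fin (N * 2)) ℂ :=
  (Matrix.of fun m i => splitVector α β i m)ᴴ

/-! ### Wavelet and wavelet packet transforms with `k` levels of signals of length `M * 2 ^ k` -/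

/-- Half the length of the signals that are split at level `j < k`. -/
def halfLength (M k j : ℕ) : ℕ := M * 2 ^ (k - 1 - j)

theorem halfLength_mul (M : ℕ) {k : ℕ} (j : Fin k) :
    halfLength M k j * 2 * 2 ^ (j : ℕ) = M * 2 ^ k := by
  obtain ⟨j, hj⟩ := j
  have h : k = (k - 1 - j) + 1 + j := by omega
  simp only [halfLength]
  conv_rhs => rw [h]
  ring

/-- `(i, r) ↦ 2 ^ j * i + r`: the position in the full signal of the `i`-th coefficient of the
subspace with number `r` that is present after `j` complete splittings. -/
def position (M : ℕ) {k : ℕ} (j : Fin k) :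
    Fin (halfLength M k j * 2) × Fin (2 ^ (j : ℕ)) ≃ Fin (M * 2 ^ k) :=
  finProdFinEquiv.trans (finCongr (halfLength_mul M j))

/-- One splitting step for each level. -/
abbrev SplitFamily (M k : ℕ) : Type :=
  ∀ j : Fin k, Matrix (Fin (halfLength M k j * 2)) (Fin (halfLength M k j * 2)) ℂ

/-- Level `j` of the wavelet packet transform: every one of the `2 ^ j` subspaces is split. -/
noncomputable def packetStep {M k : ℕ} (S : SplitFamily M k) (j : Fin k)
    (x : Fin (M * 2 ^ k) → ℂ) : Fin (M * 2 ^ k) → ℂ := fun m =>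
  (S j *ᵥ fun i => x (position M j (i, ((position M j).symm m).2))) ((position M j).symm m).1

/-- Level `j` of the wavelet transform: only the approximation subspace `r = 0` is split
(the splitting step conditioned on the `j` lowest significant bits being `0`). -/
noncomputable def waveletStep {M k : ℕ} (S : SplitFamily M k) (j : Fin k)
    (x : Fin (M * 2 ^ k) → ℂ) : Fin (M * 2 ^ k) → ℂ := fun m =>
  if ((position M j).symm m).2.val = 0 then packetStep S j x m else x m

/-- The wavelet packet transform: the levels `0, 1, …, k - 1` in this order. -/
noncomputable def packetTransform {M k : ℕ} (S : SplitFamily M k) (x : Fin (M * 2 ^ k) → ℂ) :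
    Fin (M * 2 ^ k) → ℂ :=
  (List.finRange k).foldl (fun y j => packetStep S j y) x

/-- The wavelet transform: the levels `0, 1, …, k - 1` in this order. -/
noncomputable def waveletTransform {M k : ℕ} (S : SplitFamily M k) (x : Fin (M * 2 ^ k) → ℂ) :
    Fin (M * 2 ^ k) → ℂ :=
  (List.finRange k).foldl (fun y j => waveletStep S j y) x

/-! ### Circuits acting on functions of basis states -/

/-! A number `m = r + 2^j * i` has `r` in its `j` lowest qubits and `i` in the others. So level `j`
of the packet transform is `SPLIT_j` on the high qubits: a circuit on `n - j` data qubits, placed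
there, splits all `2^j` subsequences at once with the same gates (`Impl.packetStep`). Conversely,
the subsequence `r = 0` is encoded with the low qubits in `|0⟩`, exactly like clean ancillas;
reading them as ancillas turns a circuit for the conditioned step into one for `SPLIT_j`
(`Impl.of_waveletStep`). Every upper bound therefore reduces to the conditioned steps.

A conditioned rotation computes the flag "the low bits vanish" into an ancilla, applies a controlled
one-qubit gate and clears the flag. A conditioned translation permutes basis states by an addition
modulo `M * 2^k` on the multiples of `2^j`. Straight-line programs with `O(n)` steps compute the
digits of this permutation and of its inverse, and reversible evaluation turns both programs into a
circuit with clean ancillas (`exists_permutation`). Hence each factor costs `O(n)` gates, and the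
product structure and `k ≤ n` give the rest.

Strictness: an unconditioned local rotation is one gate, while at most one gate can implement a
conditioned one with `j ≥ 1` only if `U` is scalar (`scalar_of_impl`).

Gates act on functions of basis states (`run`) rather than by matrices, so qubit types may be
infinite: ancillas are indexed by `ℕ` as needed, and `Impl.exists_circuit` returns to finitely many.
-/

theorem extend_extend {Q Q' : Type} {φ : Q → Q'} (hφ : Function.Injective φ) (b₁ b₂ : Q → Fin 2)
    (b : Q' → Fin 2) :
    Function.extend φ b₁ (Function.extend φ b₂ b) = Function.extend φ b₁ b := by
  ext1 p
  by_cases hp : ∃ p', φ p' = p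
  · obtain ⟨p', rfl⟩ := hp
    simp [hφ.extend_apply]
  · simp [Function.extend_apply' _ _ _ hp]

/-- The action of a gate on states, for an arbitrary type of qubits. -/
def Gate.act {Q : Type} [DecidableEq Q] : Gate Q → ((Q → Fin 2) → ℂ) → ((Q → Fin 2) → ℂ)
  | .single q U => fun ψ b => ∑ x, U.1 (b q) x * ψ (Function.update b q x)
  | .cnot c t _ => fun ψ b => ψ (Function.update b t (b t + b c))

/-- The action of a list of gates, the head being applied first. -/
def run {Q : Type} [DecidableEq Q] (c : List (Gate Q)) (ψ : (Q → Fin 2) → ℂ) :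
    (Q → Fin 2) → ℂ :=
  c.foldl (fun φ g => g.act φ) ψ

section
variable {Q Q' : Type} [DecidableEq Q] [DecidableEq Q']

@[simp] theorem run_nil (ψ : (Q → Fin 2) → ℂ) : run [] ψ = ψ := rfl

@[simp] theorem run_cons (g : Gate Q) (c : List (Gate Q)) (ψ : (Q → Fin 2) → ℂ) :
    run (g :: c) ψ = run c (g.act ψ) := rfl

@[simp] theorem run_append (c c' : List (Gate Q)) (ψ : (Q → Fin 2) → ℂ) :
    run (c ++ c') ψ = run c' (run c ψ) := by
  simp [run]

theorem Gate.act_add (g : Gate Q) (ψ φ : (Q → Fin 2) → ℂ) :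
    g.act (ψ + φ) = g.act ψ + g.act φ := by
  cases g <;> ext b
  · simp [Gate.act, mul_add]
    ring
  · simp [Gate.act]

theorem Gate.act_smul (g : Gate Q) (z : ℂ) (ψ : (Q → Fin 2) → ℂ) :
    g.act (z • ψ) = z • g.act ψ := by
  cases g <;> ext b
  · simp [Gate.act]
    ring
  · simp [Gate.act]

theorem run_add (c : List (Gate Q)) (ψ φ : (Q → Fin 2) → ℂ) :
    run c (ψ + φ) = run c ψ + run c φ := by
  induction c generalizing ψ φ with
  | nil => rfl
  | cons g c ih => simp [Gate.act_add, ih]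

theorem run_smul (c : List (Gate Q)) (z : ℂ) (ψ : (Q → Fin 2) → ℂ) :
    run c (z • ψ) = z • run c ψ := by
  induction c generalizing ψ with
  | nil => rfl
  | cons g c ih => simp [Gate.act_smul, ih]

theorem run_zero (c : List (Gate Q)) : run c 0 = 0 := by
  simpa using run_smul c 0 0

theorem run_sum {ι : Type*} (c : List (Gate Q)) (s : Finset ι) (ψ : ι → (Q → Fin 2) → ℂ) :
    run c (∑ i ∈ s, ψ i) = ∑ i ∈ s, run c (ψ i) := by
  classical
  induction s using Finset.induction_on with
  | empty => simp [run_zero]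
  | insert i s hi ih => simp [Finset.sum_insert hi, run_add, ih]

theorem update_add_update {c t : Q} (h : c ≠ t) (b : Q → Fin 2) :
    (fun b : Q → Fin 2 => Function.update b t (b t + b c))
      (Function.update b t (b t + b c)) = b := by
  have h2 : ∀ x y : Fin 2, x + y + y = x := by decide
  ext1 q
  by_cases hq : q = t
  · subst hq; simp [h, h2]
  · simp [hq]

theorem Gate.toMatrix_mulVec [Fintype Q] (g : Gate Q) (ψ : (Q → Fin 2) → ℂ) :
    g.toMatrix *ᵥ ψ = g.act ψ := by
  ext b
  cases g with
  | single q U =>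
    simp only [Matrix.mulVec, dotProduct, Gate.toMatrix, Gate.act]
    -- Row `b` is supported on the states that agree with `b` off `q`; these are parametrised by
    -- their digit at `q`.
    symm
    apply Finset.sum_of_injOn (fun x => Function.update b q x)
    · intro x _ y _ h
      simpa using congrFun h q
    · simp
    · intro b' _ hb'
      rw [if_neg, zero_mul]
      intro h
      apply hb'
      refine ⟨b' q, by simp, ?_⟩
      ext1 p
      by_cases hp : p = q
      · subst hp; simp
      · simp [hp, h p hp]
    · intro x _
      rw [if_pos]
      · simp
      · intro p hp; simp [hp]
  | cnot c t h =>
    simp only [Matrix.mulVec, dotProduct, Gate.toMatrix, Gate.act]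
    have key : ∀ b' : Q → Fin 2, b = Function.update b' t (b' t + b' c) ↔
        b' = Function.update b t (b t + b c) := by
      intro b'
      constructor
      · rintro rfl; exact (update_add_update h b').symm
      · rintro rfl; exact (update_add_update h b).symm
    simp [key]

/-- Relabelling the qubits of a gate. -/
def Gate.map (φ : Q → Q') (hφ : Function.Injective φ) : Gate Q → Gate Q'
  | .single q U => .single (φ q) U
  | .cnot c t h => .cnot (φ c) (φ t) (hφ.ne h)

theorem extend_update_comp {φ : Q → Q'} (hφ : Function.Injective φ) (b : Q' → Fin 2) (q : Q)
    (x : Fin 2) :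
    Function.extend φ (Function.update (b ∘ φ) q x) b = Function.update b (φ q) x := by
  ext1 p
  by_cases hp : ∃ p', φ p' = p
  · obtain ⟨p', rfl⟩ := hp
    rw [hφ.extend_apply]
    by_cases h : p' = q
    · subst h; simp
    · simp [h, hφ.ne h]
  · rw [Function.extend_apply' _ _ _ hp, Function.update_of_ne]
    rintro rfl
    exact hp ⟨q, rfl⟩

/-- `Function.extend φ b' b` carries `b'` on the relabelled qubits and `b` elsewhere. With the other
qubits frozen at `b`, the state restricts to a function on `Q → Fin 2`, and the gate acts on this
slice. -/
theorem Gate.act_map {φ : Q → Q'} (hφ : Function.Injective φ) (g : Gate Q)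
    (ψ : (Q' → Fin 2) → ℂ) (b : Q' → Fin 2) :
    (g.map φ hφ).act ψ b = g.act (fun b' => ψ (Function.extend φ b' b)) (b ∘ φ) := by
  cases g with
  | single q U => simp only [Gate.map, Gate.act, extend_update_comp hφ]; rfl
  | cnot c t h => simp only [Gate.map, Gate.act, extend_update_comp hφ]; rfl

theorem run_map {φ : Q → Q'} (hφ : Function.Injective φ) (c : List (Gate Q))
    (ψ : (Q' → Fin 2) → ℂ) (b : Q' → Fin 2) :
    run (c.map (Gate.map φ hφ)) ψ b = run c (fun b' => ψ (Function.extend φ b' b)) (b ∘ φ) := by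
  induction c generalizing ψ with
  | nil =>
    simp only [List.map_nil, run_nil]
    congr 1
    ext1 p
    by_cases hp : ∃ p', φ p' = p
    · obtain ⟨p', rfl⟩ := hp
      simp [hφ.extend_apply]
    · simp [Function.extend_apply' _ _ _ hp]
  | cons g c ih =>
    simp only [List.map_cons, run_cons, ih]
    congr 2
    ext b'
    rw [Gate.act_map]
    simp only [extend_extend hφ]
    congr 1
    ext1 p
    simp [hφ.extend_apply]

end

theorem Circuit.toMatrix_mulVec {n a : ℕ} (c : Circuit n a) (ψ : (Fin n ⊕ Fin a → Fin 2) → ℂ) :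
    c.toMatrix *ᵥ ψ = run c ψ := by
  induction c generalizing ψ with
  | nil => simp [Circuit.toMatrix]
  | cons g c ih =>
    rw [Circuit.toMatrix, ← Matrix.mulVec_mulVec, Gate.toMatrix_mulVec, ih, run_cons]

/-! ### Registers with an arbitrary type of ancilla qubits -/

/-- The number held by a register. -/
def regVal {n : ℕ} (d : Fin n → Fin 2) : ℕ := (finFunctionFinEquiv d).val

/-- The binary digits of a number. -/
def regBits (n m : ℕ) : Fin n → Fin 2 := fun i => ⟨m / 2 ^ (i : ℕ) % 2, Nat.mod_lt _ two_pos⟩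

theorem regVal_lt {n : ℕ} (d : Fin n → Fin 2) : regVal d < 2 ^ n := (finFunctionFinEquiv d).2

theorem regVal_eq_sum {n : ℕ} (d : Fin n → Fin 2) :
    regVal d = ∑ i, (d i : ℕ) * 2 ^ (i : ℕ) := by
  simp [regVal]

theorem regBits_regVal {n : ℕ} (d : Fin n → Fin 2) : regBits n (regVal d) = d :=
  finFunctionFinEquiv.symm_apply_apply d

theorem regVal_regBits {n m : ℕ} (h : m < 2 ^ n) : regVal (regBits n m) = m :=
  congrArg Fin.val (finFunctionFinEquiv.apply_symm_apply (⟨m, h⟩ : Fin (2 ^ n)))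

theorem regVal_split {n j p : ℕ} (h : n = j + p) (d : Fin n → Fin 2) :
    regVal d = regVal (fun q : Fin j => d ⟨q, by omega⟩) +
      2 ^ j * regVal (fun q : Fin p => d ⟨j + q, by omega⟩) := by
  subst h
  simp only [regVal_eq_sum, Fin.sum_univ_add, Finset.mul_sum]
  congr 1
  refine Finset.sum_congr rfl fun i _ => ?_
  simp only [Fin.val_natAdd, pow_add]
  have : Fin.natAdd j i = ⟨j + i, by omega⟩ := rfl
  rw [this]
  ring

open Classical in
/-- The state of the register that represents the signal `x`, all ancilla qubits being `|0⟩`. -/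
noncomputable def enc (n : ℕ) (A : Type) {ℓ : ℕ} (x : Fin ℓ → ℂ) : (Fin n ⊕ A → Fin 2) → ℂ :=
  fun b =>
    if h : regVal (b ∘ Sum.inl) < ℓ ∧ ∀ q : A, b (Sum.inr q) = 0 then x ⟨_, h.1⟩ else 0

theorem enc_of_eq {n : ℕ} {A : Type} {ℓ : ℕ} (x : Fin ℓ → ℂ) {b : Fin n ⊕ A → Fin 2} (m : Fin ℓ)
    (hm : regVal (b ∘ Sum.inl) = m) (hb : ∀ q : A, b (Sum.inr q) = 0) : enc n A x b = x m := by
  obtain ⟨m, hm'⟩ := m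
  simp only at hm
  subst hm
  exact dif_pos ⟨hm', hb⟩

theorem enc_of_not {n : ℕ} {A : Type} {ℓ : ℕ} (x : Fin ℓ → ℂ) {b : Fin n ⊕ A → Fin 2}
    (h : ¬ (regVal (b ∘ Sum.inl) < ℓ ∧ ∀ q : A, b (Sum.inr q) = 0)) : enc n A x b = 0 :=
  dif_neg h

theorem encode_eq_enc (n a : ℕ) {ℓ : ℕ} (x : Fin ℓ → ℂ) : encode n a x = enc n (Fin a) x := by
  ext b
  by_cases h : regVal (b ∘ Sum.inl) < ℓ ∧ ∀ q : Fin a, b (Sum.inr q) = 0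
  · rw [enc_of_eq x ⟨_, h.1⟩ rfl h.2]
    exact dif_pos h
  · rw [enc_of_not x h]
    exact dif_neg h

/-- The list of gates implements the map `V` on signals, with ancilla qubits of type `A`. -/
def Impl {n ℓ : ℕ} {A : Type} [DecidableEq A] (c : List (Gate (Fin n ⊕ A)))
    (V : (Fin ℓ → ℂ) → (Fin ℓ → ℂ)) : Prop :=
  ∀ x, run c (enc n A x) = enc n A (V x)

theorem Circuit.implements_iff {n a ℓ : ℕ} (c : Circuit n a) (V : (Fin ℓ → ℂ) → (Fin ℓ → ℂ)) :
    c.Implements V ↔ Impl c V := by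
  simp only [Circuit.Implements, Impl, Circuit.toMatrix_mulVec, encode_eq_enc]

theorem enc_extend {n ℓ : ℕ} {A A' : Type} {ι : A → A'} (hι : Function.Injective ι) (x : Fin ℓ → ℂ)
    (b : Fin n ⊕ A → Fin 2) :
    enc n A' x (Function.extend (Sum.map id ι) b 0) = enc n A x b := by
  have hφ : Function.Injective (Sum.map id ι : Fin n ⊕ A → Fin n ⊕ A') :=
    Function.injective_id.sumMap hι
  have h1 : Function.extend (Sum.map id ι) b 0 ∘ Sum.inl = b ∘ Sum.inl := by
    ext1 q
    exact hφ.extend_apply b 0 (Sum.inl q)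
  have h2 : (∀ q, Function.extend (Sum.map id ι) b 0 (Sum.inr q) = 0) ↔
      ∀ q, b (Sum.inr q) = 0 := by
    constructor
    · intro h q
      rw [← h (ι q)]
      exact (hφ.extend_apply b 0 (Sum.inr q)).symm
    · intro h q
      by_cases hq : ∃ q', ι q' = q
      · obtain ⟨q', rfl⟩ := hq
        rw [← h q']
        exact hφ.extend_apply b 0 (Sum.inr q')
      · rw [Function.extend_apply']
        · rfl
        · rintro ⟨q' | q', hq'⟩
          · simp at hq'
          · exact hq ⟨q', by simpa using hq'⟩
  by_cases h : regVal (b ∘ Sum.inl) < ℓ ∧ ∀ q : A, b (Sum.inr q) = 0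
  · rw [enc_of_eq x ⟨_, h.1⟩ rfl h.2, enc_of_eq x ⟨_, h.1⟩ (by rw [h1]) (h2.2 h.2)]
  · rw [enc_of_not x h, enc_of_not]
    rwa [h1, h2]

theorem exists_sumMap_eq {n : ℕ} {A : Type} {s : Finset A} {a : ℕ} (e : Fin a ≃ s) (q : Fin n ⊕ A)
    (hq : q.elim (fun _ => (∅ : Finset A)) (fun i => {i}) ⊆ s) :
    ∃ q' : Fin n ⊕ Fin a, Sum.map id (fun i => (e i : A)) q' = q := by
  rcases q with q | q
  · exact ⟨Sum.inl q, rfl⟩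
  · exact ⟨Sum.inr (e.symm ⟨q, by simpa using hq⟩), by simp⟩

/-! ### Changing the ancilla qubits -/

section
variable {n ℓ : ℕ} {A A' : Type} [DecidableEq A] [DecidableEq A']

theorem Impl.nil : Impl ([] : List (Gate (Fin n ⊕ A))) (id : (Fin ℓ → ℂ) → _) := fun _ => rfl

theorem Impl.append {c c' : List (Gate (Fin n ⊕ A))} {V V' : (Fin ℓ → ℂ) → (Fin ℓ → ℂ)}
    (h : Impl c V) (h' : Impl c' V') : Impl (c ++ c') (fun x => V' (V x)) := by
  intro x
  rw [run_append, h, h']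

/-- Ancilla qubits that are not used may be removed. -/
theorem Impl.of_map {ι : A → A'} (hι : Function.Injective ι) {c : List (Gate (Fin n ⊕ A))}
    {V : (Fin ℓ → ℂ) → (Fin ℓ → ℂ)}
    (h : Impl (c.map (Gate.map (Sum.map id ι) (Function.injective_id.sumMap hι))) V) :
    Impl c V := by
  intro x
  ext b
  have hφ : Function.Injective (Sum.map id ι : Fin n ⊕ A → Fin n ⊕ A') :=
    Function.injective_id.sumMap hι
  have h1 := congrFun (h x) (Function.extend (Sum.map id ι) b 0)
  rw [run_map, enc_extend hι] at h1
  simp only [extend_extend hφ, enc_extend hι] at h1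
  rw [← h1]
  congr 1
  ext1 q
  simp [hφ.extend_apply]

/-- The ancilla qubits that a gate uses. -/
def Gate.ancillas : Gate (Fin n ⊕ A) → Finset A
  | .single q _ => q.elim (fun _ => ∅) (fun i => {i})
  | .cnot c t _ => c.elim (fun _ => ∅) (fun i => {i}) ∪ t.elim (fun _ => ∅) (fun i => {i})

/-- A list of gates touches finitely many ancillas; enumerating these pulls the list back along an
injection, with the same number of gates. -/
theorem Impl.exists_circuit {c : List (Gate (Fin n ⊕ A))} {V : (Fin ℓ → ℂ) → (Fin ℓ → ℂ)}
    (h : Impl c V) : ∃ (a : ℕ) (c' : Circuit n a), c'.Implements V ∧ c'.length = c.length := by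
  classical
  set s : Finset A := c.toFinset.biUnion Gate.ancillas with hs
  let e : Fin s.card ≃ s := s.equivFin.symm
  have he : Function.Injective (fun i => (e i : A)) := Subtype.val_injective.comp e.injective
  have key : ∀ g ∈ c, ∃ g' : Gate (Fin n ⊕ Fin s.card),
      g'.map (Sum.map id (fun i => (e i : A))) (Function.injective_id.sumMap he) = g := by
    intro g hg
    have hgs : g.ancillas ⊆ s := by
      rw [hs]
      exact Finset.subset_biUnion_of_mem Gate.ancillas (List.mem_toFinset.2 hg)
    cases g with
    | single q U =>
      obtain ⟨q', rfl⟩ := exists_sumMap_eq e q hgs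
      exact ⟨.single q' U, rfl⟩
    | cnot c t hct =>
      obtain ⟨c', rfl⟩ := exists_sumMap_eq e c (Finset.union_subset_left hgs)
      obtain ⟨t', rfl⟩ := exists_sumMap_eq e t (Finset.union_subset_right hgs)
      exact ⟨.cnot c' t' (fun h => hct (by rw [h])), rfl⟩
  have key2 : ∃ c' : List (Gate (Fin n ⊕ Fin s.card)),
      c'.map (Gate.map (Sum.map id (fun i => (e i : A))) (Function.injective_id.sumMap he)) = c := by
    clear_value e s
    clear h hs
    induction c with
    | nil => exact ⟨[], rfl⟩
    | cons g c ih =>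
      obtain ⟨g', hg'⟩ := key g (by simp)
      obtain ⟨c', hc'⟩ := ih (fun g hg => key g (by simp [hg]))
      exact ⟨g' :: c', by rw [List.map_cons, hg', hc']⟩
  obtain ⟨c', hc'⟩ := key2
  refine ⟨s.card, c', ?_, ?_⟩
  · rw [Circuit.implements_iff]
    exact Impl.of_map he (by rwa [hc'])
  · rw [← hc', List.length_map]

end

/-! ### Splitting circuits inside the full register -/

theorem position_val (M : ℕ) {k : ℕ} (j : Fin k)
    (y : Fin (halfLength M k j * 2) × Fin (2 ^ (j : ℕ))) :
    (position M j y : ℕ) = y.2 + 2 ^ (j : ℕ) * y.1 := by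
  simp [position]

/-- The signal length is a multiple of `2^j`, so whether a number lies in range depends on its high
digits alone. -/
theorem regVal_low_high {n j p M k : ℕ} (h : n = j + p) (hj : j < k) (d : Fin n → Fin 2) :
    (regVal d < M * 2 ^ k ↔
      regVal (fun q : Fin p => d ⟨j + q, by omega⟩) < halfLength M k j * 2) := by
  have h1 := halfLength_mul M (⟨j, hj⟩ : Fin k)
  simp only at h1
  rw [← h1, mul_comm _ (2 ^ j), regVal_split h]
  have h2 := regVal_lt (fun q : Fin j => d ⟨q, by omega⟩)
  constructor
  · intro h3
    have : 2 ^ j * regVal (fun q : Fin p => d ⟨j + q, by omega⟩) <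
      2 ^ j * (halfLength M k j * 2) := by omega
    exact lt_of_mul_lt_mul_left this (Nat.zero_le _)
  · intro h3
    have := Nat.mul_le_mul_left (2 ^ j) (Nat.succ_le_of_lt h3)
    rw [Nat.mul_succ] at this
    omega

/-- The embedding of a register of `p` data qubits as the high part of one of `j + p` qubits. -/
def highEmb {n p : ℕ} (j : ℕ) (hn : n = j + p) {A A' : Type} (ι : A' → A) :
    Fin p ⊕ A' → Fin n ⊕ A :=
  Sum.map (fun q => ⟨j + q, by omega⟩) ι

theorem highEmb_injective {n p j : ℕ} (hn : n = j + p) {A A' : Type} {ι : A' → A}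
    (hι : Function.Injective ι) : Function.Injective (highEmb j hn ι) := by
  apply Function.Injective.sumMap _ hι
  intro q q' h
  simpa [Fin.ext_iff] using h

/-- The low qubits are never touched. For each frozen value `r` of them, the encoded signal
restricts to the encoding of subsequence `r`, on which the circuit acts as `S j`. -/
theorem Impl.packetStep {n p M k : ℕ} {A A' : Type} [DecidableEq A] [DecidableEq A'] {ι : A' → A}
    (hι : Function.Injective ι) (S : SplitFamily M k) (j : Fin k) (hn : n = j + p)
    {c : List (Gate (Fin p ⊕ A'))} (hc : Impl c (fun x => S j *ᵥ x)) :
    Impl (c.map (Gate.map (highEmb j hn ι) (highEmb_injective hn hι))) (packetStep S j) := by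
  intro x
  ext b
  have hφ := highEmb_injective (j := j) hn hι
  rw [run_map]
  set low : Fin (j : ℕ) → Fin 2 := fun q => b (Sum.inl ⟨q, by omega⟩) with hlow
  set r : Fin (2 ^ (j : ℕ)) := ⟨regVal low, regVal_lt _⟩ with hr
  have hlo : ∀ (b'' : Fin p ⊕ A' → Fin 2) (q : Fin (j : ℕ)),
      Function.extend (highEmb j hn ι) b'' b (Sum.inl ⟨q, by omega⟩) = low q := by
    intro b'' q
    rw [Function.extend_apply']
    rintro ⟨q' | q', hq'⟩
    · simp [highEmb] at hq'
      omega
    · simp [highEmb] at hq'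
  have hhi : ∀ (b'' : Fin p ⊕ A' → Fin 2) (q : Fin p),
      Function.extend (highEmb j hn ι) b'' b (Sum.inl ⟨j + q, by omega⟩) = b'' (Sum.inl q) :=
    fun b'' q => hφ.extend_apply b'' b (Sum.inl q)
  have hval : ∀ b'' : Fin p ⊕ A' → Fin 2,
      regVal (Function.extend (highEmb j hn ι) b'' b ∘ Sum.inl) =
        r + 2 ^ (j : ℕ) * regVal (b'' ∘ Sum.inl) := by
    intro b''
    rw [regVal_split hn]
    simp only [Function.comp_apply, hlo, hhi]
    rfl
  have hlt : ∀ b'' : Fin p ⊕ A' → Fin 2,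
      regVal (Function.extend (highEmb j hn ι) b'' b ∘ Sum.inl) < M * 2 ^ k ↔
        regVal (b'' ∘ Sum.inl) < halfLength M k j * 2 := by
    intro b''
    rw [regVal_low_high hn j.2]
    simp only [Function.comp_apply, hhi]
    rfl
  have hself : Function.extend (highEmb j hn ι) (b ∘ highEmb j hn ι) b = b := by
    ext1 q
    by_cases hq : ∃ q', highEmb j hn ι q' = q
    · obtain ⟨q', rfl⟩ := hq
      simp [hφ.extend_apply]
    · rw [Function.extend_apply' _ _ _ hq]
  -- If an ancilla outside the range of `ι` is `1`, the whole slice vanishes before and after;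
  -- otherwise the slice is an encoded subsequence.
  by_cases hb : ∀ q, (¬ ∃ q', ι q' = q) → b (Sum.inr q) = 0
  · have hanc : ∀ b'' : Fin p ⊕ A' → Fin 2,
        (∀ q, Function.extend (highEmb j hn ι) b'' b (Sum.inr q) = 0) ↔
          ∀ q, b'' (Sum.inr q) = 0 := by
      intro b''
      constructor
      · intro h q
        rw [← h (ι q)]
        exact (hφ.extend_apply b'' b (Sum.inr q)).symm
      · intro h q
        by_cases hq : ∃ q', ι q' = q
        · obtain ⟨q', rfl⟩ := hq
          rw [← h q']
          exact hφ.extend_apply b'' b (Sum.inr q')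
        · rw [Function.extend_apply', hb q hq]
          rintro ⟨q' | q', hq'⟩
          · simp [highEmb] at hq'
          · exact hq ⟨q', by simpa [highEmb] using hq'⟩
    have hgen : ∀ (z : Fin (M * 2 ^ k) → ℂ) (b'' : Fin p ⊕ A' → Fin 2),
        enc n A z (Function.extend (highEmb j hn ι) b'' b) =
          enc p A' (fun i => z (position M j (i, r))) b'' := by
      intro z b''
      by_cases h : regVal (b'' ∘ Sum.inl) < halfLength M k j * 2 ∧ ∀ q : A', b'' (Sum.inr q) = 0
      · rw [enc_of_eq _ ⟨_, h.1⟩ rfl h.2,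
          enc_of_eq _ (position M j (⟨_, h.1⟩, r)) _ ((hanc _).2 h.2)]
        rw [hval, position_val]
      · rw [enc_of_not _ h, enc_of_not]
        rwa [hlt, hanc]
    simp only [hgen]
    rw [hc]
    conv_rhs => rw [← hself, hgen]
    congr 1
    ext i
    simp [_root_.packetStep]
  · have hnot : ∀ (z : Fin (M * 2 ^ k) → ℂ) (b'' : Fin p ⊕ A' → Fin 2),
        enc n A z (Function.extend (highEmb j hn ι) b'' b) = 0 := by
      intro z b''
      apply enc_of_not
      rintro ⟨-, h⟩
      apply hb
      intro q hq
      rw [← h q, Function.extend_apply']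
      rintro ⟨q' | q', hq'⟩
      · simp [highEmb] at hq'
      · exact hq ⟨q', by simpa [highEmb] using hq'⟩
    simp only [hnot]
    conv_rhs => rw [← hself, hnot]
    exact congrFun (run_zero c) _

/-- Regarding the `j` lowest data qubits as ancilla qubits. -/
def lowToAncilla {n p : ℕ} (j : ℕ) (hn : n = j + p) (A : Type) :
    Fin n ⊕ A ≃ Fin p ⊕ (Fin j ⊕ A) :=
  ((Equiv.sumCongr ((finCongr hn).trans (finSumFinEquiv.symm.trans (Equiv.sumComm _ _)))
    (Equiv.refl A)).trans (Equiv.sumAssoc _ _ _))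

theorem lowToAncilla_symm_inl {n p j : ℕ} (hn : n = j + p) (A : Type) (q : Fin p) :
    (lowToAncilla j hn A).symm (Sum.inl q) = Sum.inl ⟨j + q, by omega⟩ := by
  simp [lowToAncilla, Fin.ext_iff]

theorem lowToAncilla_symm_inr_inl {n p j : ℕ} (hn : n = j + p) (A : Type) (q : Fin j) :
    (lowToAncilla j hn A).symm (Sum.inr (Sum.inl q)) = Sum.inl ⟨q, by omega⟩ := by
  simp [lowToAncilla, Fin.ext_iff]

theorem lowToAncilla_symm_inr_inr {n p j : ℕ} (hn : n = j + p) (A : Type) (q : A) :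
    (lowToAncilla j hn A).symm (Sum.inr (Sum.inr q)) = Sum.inr q := by
  simp [lowToAncilla]

theorem regVal_eq_zero_iff {n : ℕ} (d : Fin n → Fin 2) : regVal d = 0 ↔ ∀ q, d q = 0 := by
  simp [regVal_eq_sum, Finset.sum_eq_zero_iff, ← Fin.val_eq_zero_iff]

/-- A signal supported on the subsequence `r = 0` stays there under the conditioned step. Its
encoding has the low qubits in `|0⟩` at the start and at the end, as ancillas require. -/
theorem Impl.of_waveletStep {n p M k : ℕ} {A : Type} [DecidableEq A] (S : SplitFamily M k)
    (j : Fin k) (hn : n = j + p) {c : List (Gate (Fin n ⊕ A))} (hc : Impl c (waveletStep S j)) :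
    Impl (c.map (Gate.map (lowToAncilla j hn A) (lowToAncilla j hn A).injective))
      (fun x => S j *ᵥ x) := by
  intro y
  ext b
  rw [run_map]
  set e := lowToAncilla j hn A with he
  have hext : ∀ b'' : Fin n ⊕ A → Fin 2, Function.extend e b'' b = b'' ∘ e.symm := by
    intro b''
    ext1 q
    conv_lhs => rw [← e.apply_symm_apply q]
    rw [e.injective.extend_apply]
    rfl
  set x : Fin (M * 2 ^ k) → ℂ := fun m =>
    if ((position M j).symm m).2.val = 0 then y ((position M j).symm m).1 else 0 with hx
  -- Needed for the input `y` and again for the output `S j *ᵥ y`.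
  have key : ∀ (y : Fin (halfLength M k j * 2) → ℂ) (x : Fin (M * 2 ^ k) → ℂ),
      (∀ m, x m = if ((position M j).symm m).2.val = 0 then y ((position M j).symm m).1 else 0) →
      ∀ b'' : Fin n ⊕ A → Fin 2, enc p (Fin j ⊕ A) y (b'' ∘ e.symm) = enc n A x b'' := by
    intro y x hx b''
    have h1 : regVal ((b'' ∘ e.symm) ∘ Sum.inl) =
        regVal (fun q : Fin p => (b'' ∘ Sum.inl) (⟨j + q, by omega⟩ : Fin n)) := by
      exact congrArg regVal (funext fun q => congrArg b'' (lowToAncilla_symm_inl hn A q))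
    have h2 : (∀ q, (b'' ∘ e.symm) (Sum.inr q) = 0) ↔
        regVal (fun q : Fin j => (b'' ∘ Sum.inl) (⟨q, by omega⟩ : Fin n)) = 0 ∧
          ∀ q, b'' (Sum.inr q) = 0 := by
      rw [regVal_eq_zero_iff]
      simp [he, lowToAncilla_symm_inr_inl, lowToAncilla_symm_inr_inr]
    have h3 := regVal_low_high (M := M) hn j.2 (b'' ∘ Sum.inl)
    by_cases h : regVal (b'' ∘ Sum.inl) < M * 2 ^ k ∧ ∀ q, b'' (Sum.inr q) = 0
    · set i : Fin (halfLength M k j * 2) := ⟨_, h3.1 h.1⟩ with hi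
      set r : Fin (2 ^ (j : ℕ)) := ⟨_, regVal_lt (fun q : Fin j =>
        (b'' ∘ Sum.inl) (⟨q, by omega⟩ : Fin n))⟩ with hr
      rw [enc_of_eq x (position M j (i, r)) (by rw [position_val, regVal_split hn]) h.2, hx]
      simp only [Equiv.symm_apply_apply]
      split_ifs with h0
      · exact enc_of_eq y i h1 (h2.2 ⟨h0, h.2⟩)
      · exact enc_of_not y (fun hh => h0 (h2.1 hh.2).1)
    · rw [enc_of_not x h, enc_of_not]
      rintro ⟨h4, h5⟩
      rw [h1] at h4
      exact h ⟨h3.2 h4, (h2.1 h5).2⟩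
  simp only [hext, key y x (fun _ => rfl)]
  rw [hc]
  rw [← key (S j *ᵥ y)]
  · congr 1
    ext1 q
    simp
  · intro m
    simp only [waveletStep, _root_.packetStep]
    split_ifs with h
    · congr 2
      ext i
      simp only [hx, Equiv.symm_apply_apply, if_pos h]
    · simp only [hx, if_neg h]

/-! ### Basis states -/

open Classical in
/-- The basis state `|b⟩`. -/
noncomputable def ket {Q : Type} (b : Q → Fin 2) : (Q → Fin 2) → ℂ :=
  fun b' => if b' = b then 1 else 0

/-- The register holds the number `m` and all ancilla qubits are `|0⟩`. -/
def Holds {n : ℕ} {A : Type} (s : Fin n ⊕ A → Fin 2) (m : ℕ) : Prop :=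
  regVal (s ∘ Sum.inl) = m ∧ ∀ q, s (Sum.inr q) = 0

theorem regVal_injective {n : ℕ} : Function.Injective (regVal : (Fin n → Fin 2) → ℕ) :=
  fun _ _ h => finFunctionFinEquiv.injective (Fin.ext h)

theorem Holds.unique {n m : ℕ} {A : Type} {s s' : Fin n ⊕ A → Fin 2} (h : Holds s m)
    (h' : Holds s' m) : s = s' := by
  ext1 q
  rcases q with q | q
  · exact congrFun (regVal_injective (h.1.trans h'.1.symm)) q
  · rw [h.2, h'.2]

theorem enc_single {n ℓ : ℕ} {A : Type} {s : Fin n ⊕ A → Fin 2} {m : Fin ℓ} (h : Holds s m) :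
    enc n A (Pi.single m 1) = ket s := by
  ext b
  by_cases hb : b = s
  · subst hb
    rw [enc_of_eq _ m h.1 h.2]
    simp [ket]
  · rw [ket, if_neg hb]
    by_cases hb' : regVal (b ∘ Sum.inl) < ℓ ∧ ∀ q : A, b (Sum.inr q) = 0
    · rw [enc_of_eq _ ⟨_, hb'.1⟩ rfl hb'.2, Pi.single_eq_of_ne]
      intro hm
      exact hb (Holds.unique (m := m) ⟨by rw [← hm], hb'.2⟩ h)
    · rw [enc_of_not _ hb']

theorem enc_sum_smul {n ℓ : ℕ} {A ι : Type} (t : Finset ι) (z : ι → ℂ) (x : ι → Fin ℓ → ℂ) :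
    enc n A (∑ i ∈ t, z i • x i) = ∑ i ∈ t, z i • enc n A (x i) := by
  ext b
  simp only [Finset.sum_apply, Pi.smul_apply]
  by_cases hb : regVal (b ∘ Sum.inl) < ℓ ∧ ∀ q : A, b (Sum.inr q) = 0
  · simp only [fun x : Fin ℓ → ℂ => enc_of_eq x ⟨_, hb.1⟩ rfl hb.2, Finset.sum_apply,
      Pi.smul_apply]
  · simp only [fun x : Fin ℓ → ℂ => enc_of_not x hb, smul_zero, Finset.sum_const_zero]

theorem exists_holds {n m : ℕ} (A : Type) (h : m < 2 ^ n) :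
    ∃ s : Fin n ⊕ A → Fin 2, Holds s m :=
  ⟨Sum.elim (regBits n m) 0, regVal_regBits h, fun _ => rfl⟩

/-- A linear map is implemented if it is implemented on basis states. -/
theorem impl_of_ket {n ℓ : ℕ} {A : Type} [DecidableEq A] {c : List (Gate (Fin n ⊕ A))}
    {V : (Fin ℓ → ℂ) → (Fin ℓ → ℂ)} (hV : IsLinearMap ℂ V) (hℓ : ℓ ≤ 2 ^ n)
    (h : ∀ (m : Fin ℓ) (s : Fin n ⊕ A → Fin 2), Holds s m →
      run c (ket s) = enc n A (V (Pi.single m 1))) : Impl c V := by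
  intro x
  have hx : x = ∑ m, x m • Pi.single m (1 : ℂ) := by
    ext i
    simp [Finset.sum_apply, Pi.single_apply]
  have hVx : V x = ∑ m, x m • V (Pi.single m 1) := by
    conv_lhs => rw [hx]
    change hV.mk' V _ = _
    simp only [map_sum, map_smul]
    rfl
  rw [hVx, enc_sum_smul]
  conv_lhs => rw [hx, enc_sum_smul, run_sum]
  refine Finset.sum_congr rfl fun m _ => ?_
  obtain ⟨s, hs⟩ := exists_holds A (m.2.trans_le hℓ)
  rw [run_smul, enc_single hs, h m s hs]

/-! ### Conditioned splitting steps on basis signals -/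

theorem packetStep_isLinearMap {M k : ℕ} (S : SplitFamily M k) (j : Fin k) :
    IsLinearMap ℂ (packetStep S j) where
  map_add x y := by
    ext m
    simp only [packetStep, Pi.add_apply]
    rw [← Pi.add_apply, ← Matrix.mulVec_add]
    rfl
  map_smul z x := by
    ext m
    simp only [packetStep, Pi.smul_apply]
    rw [← Pi.smul_apply, ← Matrix.mulVec_smul]
    rfl

theorem waveletStep_isLinearMap {M k : ℕ} (S : SplitFamily M k) (j : Fin k) :
    IsLinearMap ℂ (waveletStep S j) where
  map_add x y := by
    ext m
    simp only [waveletStep, (packetStep_isLinearMap S j).map_add, Pi.add_apply]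
    split_ifs <;> rfl
  map_smul z x := by
    ext m
    simp only [waveletStep, (packetStep_isLinearMap S j).map_smul, Pi.smul_apply]
    split_ifs <;> rfl

theorem waveletStep_position {M k : ℕ} (S : SplitFamily M k) (j : Fin k)
    (x : Fin (M * 2 ^ k) → ℂ) (y : Fin (halfLength M k j * 2) × Fin (2 ^ (j : ℕ))) :
    waveletStep S j x (position M j y) =
      if y.2.val = 0 then (S j *ᵥ fun i => x (position M j (i, y.2))) y.1
      else x (position M j y) := by
  simp [waveletStep, packetStep]

theorem waveletStep_single_of_ne {M k : ℕ} (S : SplitFamily M k) (j : Fin k)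
    (i : Fin (halfLength M k j * 2)) {r : Fin (2 ^ (j : ℕ))} (hr : r.val ≠ 0) :
    waveletStep S j (Pi.single (position M j (i, r)) 1) = Pi.single (position M j (i, r)) 1 := by
  ext m
  obtain ⟨⟨i', r'⟩, rfl⟩ := (position M j).surjective m
  rw [waveletStep_position]
  split_ifs with h
  · have h0 : ∀ i'', (Pi.single (position M j (i, r)) 1 : Fin (M * 2 ^ k) → ℂ)
        (position M j (i'', r')) = 0 := by
      intro i''
      apply Pi.single_eq_of_ne
      intro h'
      simp only [EmbeddingLike.apply_eq_iff_eq, Prod.mk.injEq] at h'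
      exact hr (h'.2 ▸ h)
    simp only [h0]
    exact congrFun (Matrix.mulVec_zero _) i'
  · rfl

theorem waveletStep_single {M k : ℕ} (S : SplitFamily M k) (j : Fin k)
    (i : Fin (halfLength M k j * 2)) {r : Fin (2 ^ (j : ℕ))} (hr : r.val = 0) :
    waveletStep S j (Pi.single (position M j (i, r)) 1) =
      ∑ i', S j i' i • Pi.single (position M j (i', r)) 1 := by
  ext m
  obtain ⟨⟨i', r'⟩, rfl⟩ := (position M j).surjective m
  rw [waveletStep_position]
  simp only [Finset.sum_apply, Pi.smul_apply, Pi.single_apply, EmbeddingLike.apply_eq_iff_eq,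
    Prod.mk.injEq]
  by_cases h : r'.val = 0
  · have : r' = r := Fin.ext (h.trans hr.symm)
    simp [this, hr, Matrix.mulVec, dotProduct]
  · have : r' ≠ r := fun h' => h (h' ▸ hr)
    simp [this, h]

theorem localRotation_apply (N : ℕ) (U : Matrix.unitaryGroup (Fin 2) ℂ) (a a' : Fin N)
    (y y' : Fin 2) :
    localRotation N U (finProdFinEquiv (a', y')) (finProdFinEquiv (a, y)) =
      if a' = a then U.1 y' y else 0 := by
  simp [localRotation, Matrix.one_apply]

theorem waveletStep_single_localRotation {M k : ℕ} (S : SplitFamily M k) (j : Fin k)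
    (U : Matrix.unitaryGroup (Fin 2) ℂ) (hS : S j = localRotation (halfLength M k j) U)
    (a : Fin (halfLength M k j)) (y : Fin 2) {r : Fin (2 ^ (j : ℕ))} (hr : r.val = 0) :
    waveletStep S j (Pi.single (position M j (finProdFinEquiv (a, y), r)) 1) =
      ∑ x, U.1 x y • Pi.single (position M j (finProdFinEquiv (a, x), r)) 1 := by
  rw [waveletStep_single S j _ hr, hS, ← finProdFinEquiv.sum_comp, Fintype.sum_prod_type]
  simp only [localRotation_apply, ite_smul, zero_smul]
  rw [Finset.sum_eq_single a]
  · simp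
  · intro b _ hb; simp [hb]
  · simp

theorem regVal_update {n : ℕ} (d : Fin n → Fin 2) (q : Fin n) (x : Fin 2) :
    regVal (Function.update d q x) + d q * 2 ^ (q : ℕ) = regVal d + x * 2 ^ (q : ℕ) := by
  simp only [regVal_eq_sum]
  rw [← Finset.add_sum_erase _ _ (Finset.mem_univ q),
    ← Finset.add_sum_erase _ (fun i => (d i : ℕ) * 2 ^ (i : ℕ)) (Finset.mem_univ q)]
  rw [Finset.sum_congr rfl (g := fun i => (d i : ℕ) * 2 ^ (i : ℕ))]
  · simp; ring
  · intro i hi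
    rw [Function.update_of_ne (Finset.ne_of_mem_erase hi)]

theorem update_comp_inl {n : ℕ} {A : Type} [DecidableEq A] (s : Fin n ⊕ A → Fin 2) (q : Fin n)
    (x : Fin 2) :
    Function.update s (Sum.inl q) x ∘ Sum.inl = Function.update (s ∘ Sum.inl) q x := by
  ext1 p
  by_cases h : p = q
  · subst h; simp
  · simp [h]

theorem apply_eq_regVal_div {n : ℕ} (d : Fin n → Fin 2) (q : Fin n) :
    (d q : ℕ) = regVal d / 2 ^ (q : ℕ) % 2 := by
  conv_lhs => rw [← regBits_regVal d]
  rfl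

/-- The conditioned splitting step with a local rotation as splitting step, on basis states. -/
theorem enc_waveletStep_localRotation {n M k : ℕ} {A : Type} [DecidableEq A] (S : SplitFamily M k)
    (j : Fin k) (hj : (j : ℕ) < n)
    (U : Matrix.unitaryGroup (Fin 2) ℂ) (hS : S j = localRotation (halfLength M k j) U)
    {m : Fin (M * 2 ^ k)} {s : Fin n ⊕ A → Fin 2} (h : Holds s m) :
    enc n A (waveletStep S j (Pi.single m 1)) =
      if (m : ℕ) % 2 ^ (j : ℕ) = 0 then
        ∑ x, U.1 x (s (Sum.inl ⟨j, hj⟩)) • ket (Function.update s (Sum.inl ⟨j, hj⟩) x)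
      else ket s := by
  obtain ⟨⟨i, r⟩, rfl⟩ := (position M j).surjective m
  have hmod : (position M j (i, r) : ℕ) % 2 ^ (j : ℕ) = r := by
    rw [position_val, Nat.add_mul_mod_self_left, Nat.mod_eq_of_lt r.2]
  rw [hmod]
  split_ifs with hr
  · obtain ⟨⟨a, y⟩, rfl⟩ := finProdFinEquiv.surjective i
    -- Qubit `j` holds the last bit `y` of the index `y + 2 * a`, which is the bit that `I ⊗ U`
    -- rotates.
    have hv : ∀ y, (position M j (finProdFinEquiv (a, y), r) : ℕ) = 2 ^ (j : ℕ) * (y + 2 * a) := by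
      intro y
      rw [position_val]
      simp [hr]
    have hs := h.1
    rw [hv] at hs
    have hsy : s (Sum.inl ⟨j, hj⟩) = y := by
      have := apply_eq_regVal_div (s ∘ Sum.inl) ⟨j, hj⟩
      rw [hs, Nat.mul_div_cancel_left _ (by positivity)] at this
      apply Fin.ext
      simp only [Function.comp_apply] at this
      omega
    rw [waveletStep_single_localRotation S j U hS a y hr, enc_sum_smul, hsy]
    refine Finset.sum_congr rfl fun x _ => ?_
    congr 1
    refine enc_single ⟨?_, fun q => ?_⟩
    · rw [update_comp_inl, hv]
      have := regVal_update (s ∘ Sum.inl) ⟨j, hj⟩ x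
      rw [hs, Function.comp_apply, hsy] at this
      simp only at this
      have e1 := mul_add (2 ^ (j : ℕ)) (y : ℕ) (2 * a)
      have e2 := mul_add (2 ^ (j : ℕ)) (x : ℕ) (2 * a)
      have e3 := mul_comm (2 ^ (j : ℕ)) (y : ℕ)
      have e4 := mul_comm (2 ^ (j : ℕ)) (x : ℕ)
      omega
    · simpa using h.2 q
  · rw [waveletStep_single_of_ne S j i hr, enc_single h]

/-! ### A single gate does not implement a conditioned rotation -/

theorem ket_self {Q : Type} (b : Q → Fin 2) : ket b b = 1 := if_pos rfl

theorem ket_of_ne {Q : Type} {b b' : Q → Fin 2} (h : b' ≠ b) : ket b b' = 0 := if_neg h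

theorem ket_congr {Q Q' : Type} {b b' : Q → Fin 2} {s s' : Q' → Fin 2} (h : b' = b ↔ s' = s) :
    ket b b' = ket s s' := by
  by_cases hb : b' = b
  · rw [hb, h.1 hb, ket_self, ket_self]
  · rw [ket_of_ne hb, ket_of_ne (mt h.2 hb)]

theorem act_single_one {Q : Type} [DecidableEq Q] (q : Q) (ψ : (Q → Fin 2) → ℂ) :
    (Gate.single q 1).act ψ = ψ := by
  ext b
  simp [Gate.act, Matrix.one_apply]

/-- The basis state with the digits `i` and `r` at the distinct qubits `t` and `q`. -/
def twoDigits {Q : Type} [DecidableEq Q] (t q : Q) (i r : Fin 2) : Q → Fin 2 :=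
  Function.update (Function.update 0 t i) q r

/-- A one-qubit gate on `t` cannot see `q`, so the identity at `q = 1` forces `U = 1`. A one-qubit
gate elsewhere cannot change the digit at `t`, so `U` is diagonal with both entries equal to one
entry of the gate. A controlled not fixes the zero state and has entries `0` and `1`, so unitarity
leaves only `U = 1`. -/
theorem scalar_of_act {Q : Type} [DecidableEq Q] {t q : Q} (htq : t ≠ q) (g : Gate Q)
    (U : Matrix.unitaryGroup (Fin 2) ℂ)
    (h0 : ∀ i i', g.act (ket (twoDigits t q i 0)) (twoDigits t q i' 0) = U.1 i' i)
    (h1 : ∀ i i', g.act (ket (twoDigits t q i 1)) (twoDigits t q i' 1) = if i' = i then 1 else 0) :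
    ∃ z : ℂ, U.1 = z • 1 := by
  have ht : ∀ i r, twoDigits t q i r t = i := by intro i r; simp [twoDigits, htq]
  have hup : ∀ i r x, Function.update (twoDigits t q i r) t x = twoDigits t q x r := by
    intro i r x
    simp only [twoDigits]
    rw [Function.update_comm htq.symm, Function.update_idem]
  have hket : ∀ i i' r, ket (twoDigits t q i r) (twoDigits t q i' r) = if i' = i then 1 else 0 := by
    intro i i' r
    split_ifs with h
    · rw [h, ket_self]
    · refine ket_of_ne fun h' => h ?_
      rw [← ht i r, ← h', ht]
  cases g with
  | single p V =>
    by_cases hp : p = t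
    · subst hp
      simp only [Gate.act, ht, hup, hket] at h0 h1
      refine ⟨1, ?_⟩
      ext i' i
      rw [← h0]
      have := h1 i i'
      simp only [mul_ite, mul_one, mul_zero] at this ⊢
      rw [this, one_smul, Matrix.one_apply]
    · refine ⟨V.1 0 0, ?_⟩
      ext i' i
      rw [← h0]
      by_cases hi : i' = i
      · subst hi
        -- This covers `p = q` as well, whose digit is also `0` here, so only the entry `V.1 0 0`
        -- enters.
        have hp0 : twoDigits t q i' 0 p = 0 := by
          by_cases hpq : p = q
          · subst hpq; simp [twoDigits]
          · simp [twoDigits, hp, hpq]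
        have h2 : ket (twoDigits t q i' 0) (Function.update (twoDigits t q i' 0) p 0) = 1 := by
          rw [Function.update_eq_self_iff.2 hp0.symm, ket_self]
        have h3 : ket (twoDigits t q i' 0) (Function.update (twoDigits t q i' 0) p 1) = 0 := by
          refine ket_of_ne fun h' => ?_
          have := congrFun h' p
          rw [hp0] at this
          simp at this
        simp [Gate.act, hp0, h2, h3]
      · simp only [Gate.act]
        rw [Finset.sum_eq_zero]
        · simp [hi]
        · intro x _
          rw [ket_of_ne, mul_zero]
          intro h'
          have := congrFun h' t
          rw [Function.update_of_ne (Ne.symm hp), ht, ht] at this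
          exact hi this
  | cnot c' t' hct =>
    simp only [Gate.act] at h0
    have hzero : twoDigits t q 0 0 = 0 := by
      simp [twoDigits]
    have hU00 : U.1 0 0 = 1 := by
      rw [← h0, hzero, ket, if_pos]
      simp
    have hU01 : U.1 0 1 = 0 := by
      rw [← h0, ket_of_ne]
      intro h
      have := congrFun h t
      rw [hzero, ht] at this
      simp at this
    have hU11 : U.1 1 1 = 0 ∨ U.1 1 1 = 1 := by
      rw [← h0, ket]
      split_ifs <;> simp
    have hUU : U.1 * star U.1 = 1 := Matrix.mem_unitaryGroup_iff.1 U.2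
    have e1 := congrFun (congrFun hUU 0) 1
    have e2 := congrFun (congrFun hUU 1) 1
    simp only [Matrix.mul_apply, Matrix.star_apply, Fin.sum_univ_two, hU00, hU01] at e1 e2
    have hU10 : U.1 1 0 = 0 := by simpa using e1
    have hU11 : U.1 1 1 = 1 := by
      rcases hU11 with h | h
      · simp [h, hU10] at e2
      · exact h
    refine ⟨1, ?_⟩
    ext i' i
    fin_cases i' <;> fin_cases i <;> simp [hU00, hU01, hU10, hU11]

/-- Four basis states suffice: qubit `j` is rotated or not according to qubit `0`, which is one of
the conditioning bits because `j > 0`. -/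
theorem scalar_of_impl {n M k : ℕ} {A : Type} [DecidableEq A] (hM : 0 < M) (S : SplitFamily M k)
    (j : Fin k) (hj0 : 0 < (j : ℕ)) (hj : (j : ℕ) < n) (U : Matrix.unitaryGroup (Fin 2) ℂ)
    (hS : S j = localRotation (halfLength M k j) U) {c : List (Gate (Fin n ⊕ A))}
    (hc : Impl c (waveletStep S j)) (hlen : c.length ≤ 1) : ∃ z : ℂ, U.1 = z • 1 := by
  obtain ⟨g, hg⟩ : ∃ g : Gate (Fin n ⊕ A), ∀ ψ, run c ψ = g.act ψ := by
    match c, hlen with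
    -- The empty circuit counts as an identity gate.
    | [], _ => exact ⟨.single (Sum.inl ⟨j, hj⟩) 1, fun ψ => (act_single_one _ ψ).symm⟩
    | [g], _ => exact ⟨g, fun ψ => rfl⟩
  have htq : (Sum.inl ⟨j, hj⟩ : Fin n ⊕ A) ≠ Sum.inl ⟨0, by omega⟩ := by
    simp [hj0.ne']
  have hholds : ∀ i r : Fin 2, Holds (twoDigits (Sum.inl ⟨j, hj⟩ : Fin n ⊕ A)
      (Sum.inl ⟨0, by omega⟩) i r) (r + 2 ^ (j : ℕ) * i) := by
    intro i r
    refine ⟨?_, fun q => by simp [twoDigits]⟩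
    rw [twoDigits, update_comp_inl, update_comp_inl]
    have h1 := regVal_update (0 : Fin n → Fin 2) ⟨j, hj⟩ i
    have h2 := regVal_update (Function.update (0 : Fin n → Fin 2) ⟨j, hj⟩ i) ⟨0, by omega⟩ r
    have h3 : regVal (0 : Fin n → Fin 2) = 0 := (regVal_eq_zero_iff _).2 fun _ => rfl
    rw [h3] at h1
    rw [Function.update_of_ne (by simp [Fin.ext_iff, hj0.ne])] at h2
    simp only [Pi.zero_apply, Fin.val_zero, zero_mul, add_zero, zero_add, pow_zero, mul_one]
      at h1 h2
    change regVal (Function.update (Function.update (0 : Fin n → Fin 2) _ i) _ r) = _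
    rw [h2, h1]
    ring
  have hpow : 2 ≤ 2 ^ (j : ℕ) := by
    calc 2 = 2 ^ 1 := rfl
      _ ≤ 2 ^ (j : ℕ) := Nat.pow_le_pow_right (by norm_num) hj0
  -- The largest of the four numbers is `1 + 2^j < 2 * 2^j`, and the length is at least `2 * 2^j`.
  have hlt : ∀ i r : Fin 2, (r : ℕ) + 2 ^ (j : ℕ) * i < M * 2 ^ k := by
    intro i r
    rw [← halfLength_mul M j]
    have h1 : 1 ≤ halfLength M k j := Nat.mul_pos hM (by positivity)
    have h2 : 1 * 2 * 2 ^ (j : ℕ) ≤ halfLength M k j * 2 * 2 ^ (j : ℕ) := by gcongr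
    have h3 : 2 ^ (j : ℕ) * (i : ℕ) ≤ 2 ^ (j : ℕ) * 1 := by
      gcongr; omega
    omega
  have hmod : ∀ i r : Fin 2, ((r : ℕ) + 2 ^ (j : ℕ) * i) % 2 ^ (j : ℕ) = r := by
    intro i r
    rw [Nat.add_mul_mod_self_left, Nat.mod_eq_of_lt (by omega)]
  have key : ∀ i r : Fin 2, _ := fun i r => hc (Pi.single ⟨_, hlt i r⟩ 1)
  refine scalar_of_act htq g U (fun i i' => ?_) (fun i i' => ?_)
  · have := key i 0
    rw [hg, enc_single (hholds i 0), enc_waveletStep_localRotation S j hj U hS (hholds i 0),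
      if_pos (by exact hmod i 0)] at this
    rw [this]
    simp only [twoDigits]
    simp only [Function.update_comm htq.symm, Function.update_idem]
    rw [Function.update_of_ne htq]
    simp only [Function.update_self, Finset.sum_apply, Pi.smul_apply]
    rw [Finset.sum_eq_single i']
    · simp [ket_self]
    · intro x _ hx
      rw [ket_of_ne, smul_zero]
      intro h
      have := congrFun h (Sum.inl ⟨j, hj⟩)
      rw [Function.update_of_ne htq, Function.update_of_ne htq] at this
      simp at this
      exact hx this.symm
    · simp
  · have := key i 1
    rw [hg, enc_single (hholds i 1), enc_waveletStep_localRotation S j hj U hS (hholds i 1),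
      if_neg (by change _ % _ ≠ 0; rw [hmod]; simp)] at this
    rw [this]
    split_ifs with h
    · rw [h, ket_self]
    · refine ket_of_ne fun h' => h ?_
      have := congrFun h' (Sum.inl ⟨j, hj⟩)
      rw [twoDigits, twoDigits, Function.update_of_ne htq, Function.update_of_ne htq] at this
      simpa using this

/-! ### Controlled gates -/

section
variable {Q : Type} [DecidableEq Q]

theorem act_single (q : Q) (U : Matrix.unitaryGroup (Fin 2) ℂ) (ψ : (Q → Fin 2) → ℂ)
    (b : Q → Fin 2) :
    (Gate.single q U).act ψ b = ∑ x, U.1 (b q) x * ψ (Function.update b q x) := rfl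

theorem act_cnot {c t : Q} (h : c ≠ t) (ψ : (Q → Fin 2) → ℂ) (b : Q → Fin 2) :
    (Gate.cnot c t h).act ψ b = ψ (Function.update b t (b t + b c)) := rfl

/-- The phase gate. -/
noncomputable def phaseGate (u : Circle) : Matrix.unitaryGroup (Fin 2) ℂ :=
  ⟨Matrix.diagonal ![1, (u : ℂ)], by
    rw [Matrix.mem_unitaryGroup_iff, Matrix.star_eq_conjTranspose, Matrix.diagonal_conjTranspose,
      Matrix.diagonal_mul_diagonal, ← Matrix.diagonal_one]
    congr 1
    ext i
    fin_cases i
    · simp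
    · simp [← Circle.coe_inv_eq_conj]⟩

theorem act_phaseGate (q : Q) (u : Circle) (ψ : (Q → Fin 2) → ℂ) (b : Q → Fin 2) :
    (Gate.single q (phaseGate u)).act ψ b = (u ^ (b q : ℕ) : Circle) * ψ b := by
  have h2 : ∀ x : Fin 2, x = 0 ∨ x = 1 := by decide
  simp only [Gate.act, phaseGate, Fin.sum_univ_two, Matrix.diagonal_apply]
  rcases h2 (b q) with h | h
  · simp [h, (Function.update_eq_self_iff (f := b)).2 h.symm]
  · simp [h, (Function.update_eq_self_iff (f := b)).2 h.symm]

/-- Multiplication by `η ^ 2` if both qubits are `1`. -/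
noncomputable def controlledPhase {c t : Q} (h : c ≠ t) (η : Circle) : List (Gate Q) :=
  [.single c (phaseGate η), .single t (phaseGate η), .cnot c t h, .single t (phaseGate η⁻¹),
    .cnot c t h]

/-- For bits, `x + y - (x xor y) = 2 * x * y`; the three phase gates contribute these exponents of
`η`. -/
theorem run_controlledPhase {c t : Q} (h : c ≠ t) (η : Circle) (ψ : (Q → Fin 2) → ℂ)
    (b : Q → Fin 2) :
    run (controlledPhase h η) ψ b = ((η ^ 2) ^ ((b c : ℕ) * (b t : ℕ)) : Circle) * ψ b := by
  have hinv : Function.update (Function.update b t (b t + b c)) t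
      (Function.update b t (b t + b c) t + Function.update b t (b t + b c) c) = b :=
    update_add_update h b
  simp only [controlledPhase, run_cons, run_nil]
  rw [act_cnot, act_phaseGate, act_cnot, act_phaseGate, act_phaseGate, hinv, Function.update_self]
  simp only [← mul_assoc, ← Circle.coe_mul]
  congr 1
  generalize b c = x
  generalize b t = y
  fin_cases x <;> fin_cases y <;> simp [pow_two]

theorem Circle.exists_sq (u : Circle) : ∃ η : Circle, η ^ 2 = u := by
  refine ⟨Circle.exp (Complex.arg u / 2), ?_⟩
  rw [pow_two, ← Circle.exp_add, add_halves, Circle.exp_arg]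

/-- Conjugating a conditioned diagonal operator by a one-qubit gate. -/
theorem run_conj (t : Q) (W : Matrix.unitaryGroup (Fin 2) ℂ) (D : List (Gate Q))
    (cond : (Q → Fin 2) → Prop) [DecidablePred cond]
    (hcond : ∀ b x, cond (Function.update b t x) ↔ cond b) (u : Fin 2 → ℂ)
    (hD : ∀ ψ b, run D ψ b = (if cond b then u (b t) else 1) * ψ b) (ψ : (Q → Fin 2) → ℂ)
    (b : Q → Fin 2) :
    run (.single t (star W) :: D ++ [.single t W]) ψ b =
      if cond b then
        ∑ x, (W.1 * Matrix.diagonal u * star W.1) (b t) x * ψ (Function.update b t x)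
      else ψ b := by
  have hWW : W.1 * star W.1 = 1 := Matrix.mem_unitaryGroup_iff.1 W.2
  -- Used with `v = u` where the condition holds and with `v = 1` elsewhere, where `W` and its
  -- adjoint cancel.
  have key : ∀ v : Fin 2 → ℂ,
      ∑ x, W.1 (b t) x * (v x * ∑ y, (star W.1) x y * ψ (Function.update b t y)) =
        ∑ x, (W.1 * Matrix.diagonal v * star W.1) (b t) x * ψ (Function.update b t x) := by
    intro v
    simp only [Matrix.mul_apply (M := W.1 * Matrix.diagonal v), Matrix.mul_diagonal, Finset.mul_sum,
      Finset.sum_mul]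
    rw [Finset.sum_comm]
    refine Finset.sum_congr rfl fun y _ => Finset.sum_congr rfl fun x _ => ?_
    ring
  simp only [List.cons_append, run_cons, run_append, run_nil]
  simp only [act_single, hD, hcond, Function.update_self, Function.update_idem]
  split_ifs with h
  · exact key u
  · have := key 1
    rw [show Matrix.diagonal (1 : Fin 2 → ℂ) = 1 from Matrix.diagonal_one, mul_one, hWW] at this
    simp only [Pi.one_apply] at this
    refine this.trans ?_
    simp [Matrix.one_apply]

/-- A unit eigenvector is completed to a unitary `W`. Then `star W * U * W` is unitary and upper
triangular, hence diagonal. -/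
theorem unitary_diagonalization (U : Matrix.unitaryGroup (Fin 2) ℂ) :
    ∃ (W : Matrix.unitaryGroup (Fin 2) ℂ) (u v : Circle),
      U.1 = W.1 * Matrix.diagonal ![(u : ℂ), (v : ℂ)] * star W.1 := by
  obtain ⟨z, hz⟩ := Module.End.exists_eigenvalue (Matrix.toLin' U.1)
  obtain ⟨x, hx⟩ := hz.exists_hasEigenvector
  have hx1 : U.1 *ᵥ x = z • x := by simpa using hx.apply_eq_smul
  have hx2 : x ≠ 0 := hx.2
  set ρ : ℝ := Complex.normSq (x 0) + Complex.normSq (x 1) with hρ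
  have hρ0 : 0 < ρ := by
    have h0 := Complex.normSq_nonneg (x 0)
    have h1 := Complex.normSq_nonneg (x 1)
    rcases h0.lt_or_eq with h | h
    · linarith
    rcases h1.lt_or_eq with h' | h'
    · linarith
    exfalso
    apply hx2
    ext i
    fin_cases i
    · exact Complex.normSq_eq_zero.1 h.symm
    · exact Complex.normSq_eq_zero.1 h'.symm
  set s : ℂ := (((Real.sqrt ρ)⁻¹ : ℝ) : ℂ) with hs
  have hss : s * s * ρ = 1 := by
    rw [hs]
    norm_cast
    rw [← mul_inv, Real.mul_self_sqrt hρ0.le, inv_mul_cancel₀ hρ0.ne']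
  have hconj : (starRingEnd ℂ) s = s := Complex.conj_ofReal _
  have hρ' : (ρ : ℂ) = x 0 * (starRingEnd ℂ) (x 0) + x 1 * (starRingEnd ℂ) (x 1) := by
    rw [hρ, Complex.mul_conj, Complex.mul_conj]
    push_cast
    rfl
  rw [hρ'] at hss
  -- The second column `(-conj x₁, conj x₀)` is orthogonal to the eigenvector; `s` normalises both.
  let Wm : Matrix (Fin 2) (Fin 2) ℂ :=
    !![s * x 0, -(s * (starRingEnd ℂ) (x 1)); s * x 1, s * (starRingEnd ℂ) (x 0)]
  have hW : Wm ∈ Matrix.unitaryGroup (Fin 2) ℂ := by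
    rw [Matrix.mem_unitaryGroup_iff]
    ext i i'
    fin_cases i <;> fin_cases i' <;>
      simp [Wm, Matrix.mul_apply, Fin.sum_univ_two, Matrix.star_apply, hconj] <;>
      first
        | linear_combination hss
        | ring
  set W : Matrix.unitaryGroup (Fin 2) ℂ := ⟨Wm, hW⟩ with hWdef
  set T : Matrix.unitaryGroup (Fin 2) ℂ := star W * U * W with hT
  have hTU : U.1 = W.1 * T.1 * star W.1 := by
    have : U = W * T * star W := by
      rw [hT]
      simp [mul_assoc, Unitary.star_eq_inv]
    exact congrArg Subtype.val this
  have hUW : ∀ i, (U.1 * W.1) i 0 = z * W.1 i 0 := by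
    intro i
    have := congrFun hx1 i
    simp only [Matrix.mulVec, dotProduct, Fin.sum_univ_two, Pi.smul_apply, smul_eq_mul] at this
    rw [Matrix.mul_apply, Fin.sum_univ_two]
    have e0 : W.1 0 0 = s * x 0 := rfl
    have e1 : W.1 1 0 = s * x 1 := rfl
    have e2 : W.1 i 0 = s * x i := by fin_cases i <;> rfl
    rw [e0, e1, e2]
    linear_combination s * this
  have hT0 : ∀ i, T.1 i 0 = if i = 0 then z else 0 := by
    intro i
    have h1 : T.1 = star W.1 * (U.1 * W.1) := by
      rw [← mul_assoc]
      rfl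
    have h2 : star W.1 * W.1 = 1 := Matrix.mem_unitaryGroup_iff'.1 W.2
    have h3 := congrFun (congrFun h2 i) 0
    rw [Matrix.mul_apply, Fin.sum_univ_two, Matrix.one_apply] at h3
    rw [h1, Matrix.mul_apply, Fin.sum_univ_two, hUW, hUW]
    have h4 : (star W.1) i 0 * (z * W.1 0 0) + (star W.1) i 1 * (z * W.1 1 0) =
      z * ((star W.1) i 0 * W.1 0 0 + (star W.1) i 1 * W.1 1 0) := by ring
    rw [h4, h3]
    simp
  have h00 : T.1 0 0 = z := by simpa using hT0 0
  have h10 : T.1 1 0 = 0 := by simpa using hT0 1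
  have hTT : T.1 * star T.1 = 1 := Matrix.mem_unitaryGroup_iff.1 T.2
  have hTT' : star T.1 * T.1 = 1 := Matrix.mem_unitaryGroup_iff'.1 T.2
  have e00 := congrFun (congrFun hTT' 0) 0
  have e01 := congrFun (congrFun hTT 0) 1
  have e11 := congrFun (congrFun hTT 1) 1
  simp only [Matrix.mul_apply, Matrix.star_apply, Fin.sum_univ_two, h10, h00, star_zero, mul_zero,
    zero_add, add_zero, Matrix.one_apply_eq] at e00 e01 e11
  have h11 : T.1 1 1 ≠ 0 := by
    intro h
    rw [h] at e11
    simp at e11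
  have h01 : T.1 0 1 = 0 := by
    rcases mul_eq_zero.1 (e01.trans (Matrix.one_apply_ne (by decide))) with h | h
    · exact h
    · exact absurd (star_eq_zero.1 h) h11
  have hnorm : ∀ w : ℂ, w * star w = 1 → w ∈ Submonoid.unitSphere ℂ := by
    intro w hw
    have h1 : Complex.normSq w = 1 := by
      have : (Complex.normSq w : ℂ) = 1 := by rw [← Complex.mul_conj]; exact hw
      exact_mod_cast this
    refine mem_sphere_zero_iff_norm.2 ?_
    rw [Complex.normSq_eq_norm_sq] at h1
    exact (pow_eq_one_iff_of_nonneg (norm_nonneg w) two_ne_zero).1 h1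
  refine ⟨W, ⟨z, hnorm z (by rw [mul_comm]; exact e00)⟩, ⟨T.1 1 1, hnorm _ e11⟩, ?_⟩
  rw [hTU]
  congr 2
  ext i i'
  fin_cases i <;> fin_cases i' <;> simp [h00, h01, h10]

/-- The controlled one-qubit operations. -/
theorem exists_controlled {c t : Q} (h : c ≠ t) (U : Matrix.unitaryGroup (Fin 2) ℂ) :
    ∃ l : List (Gate Q), l.length = 8 ∧ ∀ ψ b, run l ψ b =
      if b c = 1 then ∑ x, U.1 (b t) x * ψ (Function.update b t x) else ψ b := by
  obtain ⟨W, u, v, hU⟩ := unitary_diagonalization U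
  -- Since `diag(u, v) = u * diag(1, v / u)`, the controlled version is a phase gate `u` on the
  -- control followed by a controlled phase `v / u = η^2`.
  obtain ⟨η, hη⟩ := Circle.exists_sq (v * u⁻¹)
  refine ⟨.single t (star W) :: (.single c (phaseGate u) :: controlledPhase h η) ++ [.single t W],
    rfl, fun ψ b => ?_⟩
  rw [run_conj t W _ (fun b => b c = 1) (fun b x => by rw [Function.update_of_ne h])
    ![(u : ℂ), (v : ℂ)], hU]
  intro ψ b
  rw [run_cons, run_controlledPhase, act_phaseGate, hη, ← mul_assoc, ← Circle.coe_mul]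
  congr 1
  generalize b c = x
  generalize b t = y
  fin_cases x <;> fin_cases y <;> simp

/-- The Hadamard gate. -/
noncomputable def hadamard : Matrix.unitaryGroup (Fin 2) ℂ :=
  ⟨(((Real.sqrt 2)⁻¹ : ℝ) : ℂ) • !![1, 1; 1, -1], by
    have h : (((Real.sqrt 2)⁻¹ : ℝ) : ℂ) * (((Real.sqrt 2)⁻¹ : ℝ) : ℂ) = 1 / 2 := by
      rw [← Complex.ofReal_mul, ← mul_inv, Real.mul_self_sqrt (by norm_num)]
      norm_num
    rw [Matrix.mem_unitaryGroup_iff, star_smul, Matrix.smul_mul, Matrix.mul_smul, smul_smul]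
    have h' : star (((Real.sqrt 2)⁻¹ : ℝ) : ℂ) = (((Real.sqrt 2)⁻¹ : ℝ) : ℂ) :=
      Complex.conj_ofReal _
    rw [h', h]
    ext i i'
    rw [Matrix.smul_apply, Matrix.mul_apply, Fin.sum_univ_two]
    fin_cases i <;> fin_cases i' <;> simp [Matrix.star_apply] <;> norm_num⟩

theorem hadamard_conj (i i' : Fin 2) :
    (hadamard.1 * Matrix.diagonal ![1, -1] * star hadamard.1 : Matrix (Fin 2) (Fin 2) ℂ) i i' =
      if i' = i + 1 then 1 else 0 := by
  have h : (((Real.sqrt 2)⁻¹ : ℝ) : ℂ) * (((Real.sqrt 2)⁻¹ : ℝ) : ℂ) = 1 / 2 := by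
    rw [← Complex.ofReal_mul, ← mul_inv, Real.mul_self_sqrt (by norm_num)]
    norm_num
  have h' : star (((Real.sqrt 2)⁻¹ : ℝ) : ℂ) = (((Real.sqrt 2)⁻¹ : ℝ) : ℂ) :=
    Complex.conj_ofReal _
  simp only [hadamard, star_smul, h', Matrix.smul_mul, Matrix.mul_smul, smul_smul, h]
  rw [Matrix.smul_apply, Matrix.mul_apply, Fin.sum_univ_two, Matrix.mul_diagonal,
    Matrix.mul_diagonal]
  fin_cases i <;> fin_cases i' <;> simp [Matrix.star_apply] <;> norm_num

/-- The doubly controlled not gate. -/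
theorem exists_toffoli {a c t : Q} (hac : a ≠ c) (hat : a ≠ t) (hct : c ≠ t) :
    ∃ l : List (Gate Q), l.length = 19 ∧ ∀ ψ b, run l ψ b =
      ψ (Function.update b t (b t + b a * b c)) := by
  -- The controlled phases multiply to `ζ^(c*t - (c xor a)*t + a*t) = ζ^(2*a*c*t) = (-1)^(a*c*t)`;
  -- conjugation by the Hadamard gate turns this sign into a not on `t`.
  obtain ⟨ζ, hζ⟩ := Circle.exists_sq (Circle.exp Real.pi)
  obtain ⟨η, hη⟩ := Circle.exists_sq ζ
  have hζ' : (ζ : ℂ) * ζ = -1 := by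
    have := congrArg (fun z : Circle => (z : ℂ)) hζ
    simpa [pow_two, Circle.coe_exp] using this
  refine ⟨.single t (star hadamard) :: (controlledPhase hct η ++ [.cnot a c hac] ++
    controlledPhase hct η⁻¹ ++ [.cnot a c hac] ++ controlledPhase hat η) ++ [.single t hadamard],
    rfl, fun ψ b => ?_⟩
  rw [run_conj t hadamard _ (fun b => b a = 1 ∧ b c = 1)
    (fun b x => by rw [Function.update_of_ne hat, Function.update_of_ne hct]) ![1, -1]]
  · simp only [hadamard_conj, ite_mul, one_mul, zero_mul, Finset.sum_ite_eq', Finset.mem_univ,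
      if_true]
    have h2 : ∀ x y : Fin 2, x * y = if x = 1 ∧ y = 1 then 1 else 0 := by decide
    rw [h2]
    split_ifs with h
    · rfl
    · rw [add_zero, Function.update_eq_self]
  · intro ψ b
    have hinv : Function.update (Function.update b c (b c + b a)) c
        (Function.update b c (b c + b a) c + Function.update b c (b c + b a) a) = b :=
      update_add_update hac b
    simp only [run_append, run_controlledPhase, run_cons, run_nil]
    rw [act_cnot, run_controlledPhase, act_cnot, hinv, run_controlledPhase, Function.update_self,
      Function.update_of_ne hct.symm, inv_pow, hη]
    simp only [← mul_assoc, ← Circle.coe_mul]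
    congr 1
    generalize b c = x
    generalize b t = y
    generalize b a = z
    fin_cases x <;> fin_cases y <;> fin_cases z <;> simp [hζ']

theorem hadamard_conj_mem :
    (hadamard.1 * Matrix.diagonal ![1, -1] * star hadamard.1 : Matrix (Fin 2) (Fin 2) ℂ) ∈
      Matrix.unitaryGroup (Fin 2) ℂ := by
  rw [Matrix.mem_unitaryGroup_iff]
  ext i i'
  rw [Matrix.mul_apply, Fin.sum_univ_two]
  simp only [Matrix.star_apply, hadamard_conj]
  fin_cases i <;> fin_cases i' <;> simp

/-- The not gate. -/
theorem exists_not (q : Q) :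
    ∃ l : List (Gate Q), l.length = 1 ∧ ∀ ψ b, run l ψ b = ψ (Function.update b q (b q + 1)) := by
  refine ⟨[.single q ⟨_, hadamard_conj_mem⟩], rfl, fun ψ b => ?_⟩
  rw [run_cons, run_nil, act_single]
  simp only [hadamard_conj]
  simp

end

/-! ### Reversible evaluation of straight-line programs -/

section
variable {Q Q' : Type} [DecidableEq Q] [DecidableEq Q']

/-- Adding a function of the other qubits to the qubit `t`, on basis states. -/
theorem run_ket_of_update {l : List (Gate Q)} {t : Q} {h : (Q → Fin 2) → Fin 2}
    (hh : ∀ b x, h (Function.update b t x) = h b)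
    (hl : ∀ ψ b, run l ψ b = ψ (Function.update b t (b t + h b))) (s : Q → Fin 2) :
    run l (ket s) = ket (Function.update s t (s t + h s)) := by
  have h2 : ∀ x y : Fin 2, x + y + y = x := by decide
  have hinv : ∀ b : Q → Fin 2, Function.update (Function.update b t (b t + h b)) t
      (Function.update b t (b t + h b) t + h (Function.update b t (b t + h b))) = b := by
    intro b
    rw [hh, Function.update_self, Function.update_idem, h2, Function.update_eq_self]
  ext b
  rw [hl]
  by_cases hb : b = Function.update s t (s t + h s)
  · rw [hb, ket_self, hinv, ket_self]
  · rw [ket_of_ne hb, ket_of_ne]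
    rintro rfl
    exact hb (hinv b).symm

theorem act_cnot_ket {c t : Q} (h : c ≠ t) (s : Q → Fin 2) :
    (Gate.cnot c t h).act (ket s) = ket (Function.update s t (s t + s c)) :=
  run_ket_of_update (l := [.cnot c t h]) (h := fun b => b c)
    (fun _ _ => Function.update_of_ne h _ _) (fun _ _ => rfl) s

/-- Gates on the image of `φ` rewrite only those digits of a basis state; amplitudes vanish at
states that differ from it elsewhere. -/
theorem run_map_ket {φ : Q → Q'} (hφ : Function.Injective φ) {c : List (Gate Q)}
    {b : Q' → Fin 2} {s' : Q → Fin 2} (h : run c (ket (b ∘ φ)) = ket s') :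
    run (c.map (Gate.map φ hφ)) (ket b) = ket (Function.extend φ s' b) := by
  ext b'
  rw [run_map]
  by_cases hb : ∀ q, (¬ ∃ q', φ q' = q) → b' q = b q
  · have h1 : (fun b'' => ket b (Function.extend φ b'' b')) = ket (b ∘ φ) := by
      ext b''
      have : Function.extend φ b'' b' = b ↔ b'' = b ∘ φ := by
        constructor
        · rintro h
          ext1 q
          rw [Function.comp_apply, ← h, hφ.extend_apply]
        · rintro rfl
          ext1 q
          by_cases hq : ∃ q', φ q' = q
          · obtain ⟨q', rfl⟩ := hq
            rw [hφ.extend_apply]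
            rfl
          · rw [Function.extend_apply' _ _ _ hq, hb q hq]
      exact ket_congr this
    rw [h1, h]
    have : b' ∘ φ = s' ↔ b' = Function.extend φ s' b := by
      constructor
      · rintro rfl
        ext1 q
        by_cases hq : ∃ q', φ q' = q
        · obtain ⟨q', rfl⟩ := hq
          rw [hφ.extend_apply]
          rfl
        · rw [Function.extend_apply' _ _ _ hq, hb q hq]
      · rintro rfl
        ext1 q
        rw [Function.comp_apply, hφ.extend_apply]
    exact ket_congr this
  · push Not at hb
    obtain ⟨q, hq, hbq⟩ := hb
    have hq' : ¬ ∃ q', φ q' = q := fun ⟨q', hq'⟩ => hq q' hq'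
    have h1 : (fun b'' => ket b (Function.extend φ b'' b')) = 0 := by
      ext b''
      refine ket_of_ne fun h' => hbq ?_
      rw [← h', Function.extend_apply' _ _ _ hq']
    rw [h1, run_zero, ket_of_ne]
    · rfl
    · rintro rfl
      exact hbq (Function.extend_apply' _ _ _ hq')

end

/-- `SLP T F`: a straight-line program with `T` steps (constants, sums, products modulo `2`)
computes all Boolean functions in `F`, the inputs being free. -/
inductive SLP {n : ℕ} : ℕ → Set ((Fin n → Fin 2) → Fin 2) → Prop
  | input : SLP 0 (Set.range fun q d => d q)
  | const {T F} (h : SLP T F) (c : Fin 2) : SLP (T + 1) (insert (fun _ => c) F)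
  | add {T F f g} (h : SLP T F) (hf : f ∈ F) (hg : g ∈ F) :
      SLP (T + 1) (insert (fun d => f d + g d) F)
  | mul {T F f g} (h : SLP T F) (hf : f ∈ F) (hg : g ∈ F) :
      SLP (T + 1) (insert (fun d => f d * g d) F)

/-- A circuit `P` (with inverse `P'`) that evaluates the functions in `F` into the ancilla qubits
with numbers less than `T`; the resulting ancilla state is `G d`. -/
structure Evaluates {n : ℕ} (T : ℕ) (F : Set ((Fin n → Fin 2) → Fin 2))
    (P P' : List (Gate (Fin n ⊕ ℕ))) (G : (Fin n → Fin 2) → ℕ → Fin 2) : Prop where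
  length_le : P.length ≤ 19 * T
  length_le' : P'.length ≤ 19 * T
  eq_zero : ∀ d i, T ≤ i → G d i = 0
  run_eq : ∀ d, run P (ket (Sum.elim d 0)) = ket (Sum.elim d (G d))
  run_eq' : ∀ d, run P' (ket (Sum.elim d (G d))) = ket (Sum.elim d 0)
  wire : ∀ f ∈ F, ∃ w : Fin n ⊕ ℕ, (∀ i, T ≤ i → w ≠ Sum.inr i) ∧ ∀ d, Sum.elim d (G d) w = f d

/-- The new value is added to the fresh ancilla `T`. Since `x + x = 0`, the same gates `l` erase it
again, so the inverse circuit starts with `l`. The bound `19` is the length of the doubly controlled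
not. -/
theorem Evaluates.step {n T : ℕ} {F : Set ((Fin n → Fin 2) → Fin 2)}
    {P P' : List (Gate (Fin n ⊕ ℕ))} {G : (Fin n → Fin 2) → ℕ → Fin 2} (H : Evaluates T F P P' G)
    {l : List (Gate (Fin n ⊕ ℕ))} {h : (Fin n ⊕ ℕ → Fin 2) → Fin 2}
    (hh : ∀ b x, h (Function.update b (Sum.inr T) x) = h b)
    (hl : ∀ ψ b, run l ψ b = ψ (Function.update b (Sum.inr T) (b (Sum.inr T) + h b)))
    (hlen : l.length ≤ 19) {f : (Fin n → Fin 2) → Fin 2} (hf : ∀ d, h (Sum.elim d (G d)) = f d) :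
    ∃ P P' G, Evaluates (T + 1) (insert f F) P P' G := by
  have h2 : ∀ x : Fin 2, x + x = 0 := by decide
  have hG : ∀ d x, (Sum.elim d (Function.update (G d) T x) : Fin n ⊕ ℕ → Fin 2) =
      Function.update (Sum.elim d (G d)) (Sum.inr T) x := by
    intro d x
    rw [← Sum.update_elim_inr]
  have hGT : ∀ d, (Sum.elim d (G d) : Fin n ⊕ ℕ → Fin 2) (Sum.inr T) = 0 :=
    fun d => H.eq_zero d T le_rfl
  refine ⟨P ++ l, l ++ P', fun d => Function.update (G d) T (f d), ?_, ?_, ?_, ?_, ?_, ?_⟩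
  · rw [List.length_append]
    linarith [H.length_le]
  · rw [List.length_append]
    linarith [H.length_le']
  · intro d i hi
    rw [Function.update_of_ne (by omega)]
    exact H.eq_zero d i (by omega)
  · intro d
    rw [run_append, H.run_eq, run_ket_of_update hh hl, hGT, zero_add, hf, hG]
  · intro d
    rw [run_append, hG, run_ket_of_update hh hl, hh, hf, Function.update_self,
      Function.update_idem, h2, ← hGT d, Function.update_eq_self, H.run_eq']
  · intro g hg
    rcases hg with rfl | hg
    · exact ⟨Sum.inr T, fun i hi h => by simp at h; omega, fun d => by simp⟩
    · obtain ⟨w, hw, hwd⟩ := H.wire g hg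
      refine ⟨w, fun i hi => hw i (by omega), fun d => ?_⟩
      rw [hG, Function.update_of_ne (hw T le_rfl), hwd]

theorem SLP.exists_evaluates {n T : ℕ} {F : Set ((Fin n → Fin 2) → Fin 2)} (h : SLP T F) :
    ∃ P P' G, Evaluates T F P P' G := by
  induction h with
  | input =>
    refine ⟨[], [], fun _ => 0, by simp, by simp, fun _ _ _ => rfl, fun _ => rfl, fun _ => rfl, ?_⟩
    rintro _ ⟨q, rfl⟩
    exact ⟨Sum.inl q, by simp, fun d => rfl⟩
  | @const T F h c ih =>
    obtain ⟨P, P', G, H⟩ := ih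
    have h2 : c = 0 ∨ c = 1 := by revert c; decide
    rcases h2 with rfl | rfl
    · exact H.step (l := []) (h := fun _ => 0) (fun _ _ => rfl) (fun ψ b => by simp) (by simp)
        (fun _ => rfl)
    · obtain ⟨l, hl, hl'⟩ := exists_not (Sum.inr T : Fin n ⊕ ℕ)
      exact H.step (h := fun _ => 1) (fun _ _ => rfl) hl' (by omega) (fun _ => rfl)
  | @add T F f g h hf hg ih =>
    obtain ⟨P, P', G, H⟩ := ih
    obtain ⟨w, hw, hwd⟩ := H.wire f hf
    obtain ⟨w', hw', hwd'⟩ := H.wire g hg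
    refine H.step (l := [.cnot w' (Sum.inr T) (hw' T le_rfl), .cnot w (Sum.inr T) (hw T le_rfl)])
      (h := fun b => b w + b w')
      (fun b x => ?_) (fun ψ b => ?_) (by simp) (fun d => ?_)
    · rw [Function.update_of_ne (hw T le_rfl), Function.update_of_ne (hw' T le_rfl)]
    · rw [run_cons, run_cons, run_nil, act_cnot, act_cnot, Function.update_idem,
        Function.update_self, Function.update_of_ne (hw' T le_rfl), add_assoc]
    · rw [hwd, hwd']
  | @mul T F f g h hf hg ih =>
    obtain ⟨P, P', G, H⟩ := ih
    obtain ⟨w, hw, hwd⟩ := H.wire f hf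
    obtain ⟨w', hw', hwd'⟩ := H.wire g hg
    -- The doubly controlled not needs distinct controls; on a single wire `x * x = x` and a
    -- controlled not does the job.
    by_cases hww : w = w'
    · subst hww
      have h2 : ∀ x : Fin 2, x * x = x := by decide
      refine H.step (l := [.cnot w (Sum.inr T) (hw T le_rfl)]) (h := fun b => b w)
        (fun b x => Function.update_of_ne (hw T le_rfl) _ _) (fun ψ b => rfl) (by simp)
        (fun d => ?_)
      rw [← hwd', ← hwd, h2]
    · obtain ⟨l, hl, hl'⟩ := exists_toffoli hww (hw T le_rfl) (hw' T le_rfl)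
      refine H.step (h := fun b => b w * b w') (fun b x => ?_) hl' hl.le (fun d => ?_)
      · rw [Function.update_of_ne (hw T le_rfl), Function.update_of_ne (hw' T le_rfl)]
      · rw [hwd, hwd']

/-! ### Clean computation and reversible permutations -/

/-- The basis state with data qubits `d`, work qubits `w` and output qubits `y`. -/
def regs {n p : ℕ} (d : Fin n → Fin 2) (w : ℕ → Fin 2) (y : Fin p → Fin 2) :
    Fin n ⊕ (ℕ ⊕ Fin p) → Fin 2 :=
  Sum.elim d (Sum.elim w y)

theorem update_regs_output {n p : ℕ} (d : Fin n → Fin 2) (w : ℕ → Fin 2) (y : Fin p → Fin 2)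
    (q : Fin p) (x : Fin 2) :
    Function.update (regs d w y) (Sum.inr (Sum.inr q)) x = regs d w (Function.update y q x) := by
  simp only [regs, Sum.update_elim_inr]

theorem update_regs_data {n p : ℕ} (d : Fin n → Fin 2) (w : ℕ → Fin 2) (y : Fin p → Fin 2)
    (q : Fin n) (x : Fin 2) :
    Function.update (regs d w y) (Sum.inl q) x = regs (Function.update d q x) w y := by
  simp only [regs, Sum.update_elim_inl]

/-- The embedding of the data and work qubits. -/
def workEmb (n p : ℕ) : Fin n ⊕ ℕ → Fin n ⊕ (ℕ ⊕ Fin p) := Sum.map id Sum.inl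

theorem workEmb_injective (n p : ℕ) : Function.Injective (workEmb n p) :=
  Function.injective_id.sumMap Sum.inl_injective

theorem regs_comp_workEmb {n p : ℕ} (d : Fin n → Fin 2) (w : ℕ → Fin 2) (y : Fin p → Fin 2) :
    regs d w y ∘ workEmb n p = Sum.elim d w := by
  ext1 q
  rcases q with q | q <;> rfl

theorem extend_workEmb {n p : ℕ} (d : Fin n → Fin 2) (w w' : ℕ → Fin 2) (y : Fin p → Fin 2) :
    Function.extend (workEmb n p) (Sum.elim d w') (regs d w y) = regs d w' y := by
  ext1 q
  rcases q with q | q | q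
  · exact (workEmb_injective n p).extend_apply _ _ (Sum.inl q)
  · exact (workEmb_injective n p).extend_apply _ _ (Sum.inr q)
  · rw [Function.extend_apply']
    · rfl
    · rintro ⟨q' | q', hq'⟩ <;> simp [workEmb] at hq'

/-- Adding the values of functions computed by a straight-line program to the output register,
leaving the work qubits clean. -/
theorem SLP.exists_xor {n p T : ℕ} {F : Set ((Fin n → Fin 2) → Fin 2)} (h : SLP T F)
    (f : Fin p → (Fin n → Fin 2) → Fin 2) (hf : ∀ q, f q ∈ F) :
    ∃ c : List (Gate (Fin n ⊕ (ℕ ⊕ Fin p))), c.length ≤ 38 * T + p ∧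
      ∀ d y, run c (ket (regs d 0 y)) = ket (regs d 0 (fun q => y q + f q d)) := by
  obtain ⟨P, P', G, H⟩ := h.exists_evaluates
  choose w hw hwd using fun q => H.wire (f q) (hf q)
  have hne : ∀ q, workEmb n p (w q) ≠ Sum.inr (Sum.inr q) := by
    intro q
    rcases w q with q' | q' <;> simp [workEmb]
  have hcopy : ∀ (l : List (Fin p)), l.Nodup → ∀ d y,
      run (l.map fun q => Gate.cnot (workEmb n p (w q)) (Sum.inr (Sum.inr q)) (hne q))
        (ket (regs d (G d) y)) =
      ket (regs d (G d) (fun q => if q ∈ l then y q + f q d else y q)) := by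
    intro l
    induction l with
    | nil => intro _ d y; simp
    | cons q l ih =>
      intro hl d y
      have hw' : regs d (G d) y (workEmb n p (w q)) = f q d := by
        rw [← hwd q d, ← regs_comp_workEmb d (G d) y]
        rfl
      rw [List.map_cons, run_cons, act_cnot_ket, update_regs_output, hw', ih hl.of_cons]
      congr 2
      ext1 q'
      have hq : q ∉ l := (List.nodup_cons.1 hl).1
      by_cases hqq : q' = q
      · subst hqq
        simp [hq, regs]
      · simp [hqq]
  -- Evaluate, copy, and undo the evaluation: at most `19 * T` gates each way and `p` for the
  -- copies.
  refine ⟨P.map (Gate.map _ (workEmb_injective n p)) ++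
    ((List.finRange p).map fun q => Gate.cnot (workEmb n p (w q)) (Sum.inr (Sum.inr q)) (hne q)) ++
    P'.map (Gate.map _ (workEmb_injective n p)), ?_, fun d y => ?_⟩
  · have h1 := H.length_le
    have h2 := H.length_le'
    simp only [List.length_append, List.length_map, List.length_finRange]
    omega
  · have e1 : run P (ket (regs d 0 y ∘ workEmb n p)) = ket (Sum.elim d (G d)) := by
      rw [regs_comp_workEmb, H.run_eq]
    rw [run_append, run_append, run_map_ket _ e1, extend_workEmb, hcopy _ (List.nodup_finRange p)]
    simp only [List.mem_finRange, if_true]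
    have e2 : run P' (ket (regs d (G d) (fun q => y q + f q d) ∘ workEmb n p)) =
        ket (Sum.elim d 0) := by
      rw [regs_comp_workEmb, H.run_eq']
    rw [run_map_ket _ e2, extend_workEmb]

/-- Exchanging the data register and the output register. -/
theorem exists_swapRegisters (n : ℕ) :
    ∃ c : List (Gate (Fin n ⊕ (ℕ ⊕ Fin n))), c.length = 3 * n ∧
      ∀ d w y, run c (ket (regs d w y)) = ket (regs y w d) := by
  have key : ∀ l : List (Fin n), l.Nodup →
      ∃ c : List (Gate (Fin n ⊕ (ℕ ⊕ Fin n))), c.length = 3 * l.length ∧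
        ∀ d w y, run c (ket (regs d w y)) =
          ket (regs (fun q => if q ∈ l then y q else d q) w
            (fun q => if q ∈ l then d q else y q)) := by
    intro l
    induction l with
    | nil => intro _; exact ⟨[], rfl, fun d w y => by simp⟩
    | cons q l ih =>
      intro hl
      obtain ⟨c, hc, hrun⟩ := ih hl.of_cons
      -- Three alternating controlled nots exchange two bits.
      refine ⟨.cnot (Sum.inl q) (Sum.inr (Sum.inr q)) (by simp) ::
        .cnot (Sum.inr (Sum.inr q)) (Sum.inl q) (by simp) ::
        .cnot (Sum.inl q) (Sum.inr (Sum.inr q)) (by simp) :: c, ?_, fun d w y => ?_⟩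
      · simp only [List.length_cons, hc]; ring
      · have h2 : ∀ x y : Fin 2, x + (y + x) = y := by decide
        have h3 : ∀ x y : Fin 2, y + x + y = x := by decide
        have hq : q ∉ l := (List.nodup_cons.1 hl).1
        rw [run_cons, run_cons, run_cons, act_cnot_ket, update_regs_output, act_cnot_ket,
          update_regs_data, act_cnot_ket, update_regs_output, hrun]
        have hd : ∀ d : Fin n → Fin 2, ∀ y : Fin n → Fin 2, regs d w y (Sum.inl q) = d q :=
          fun _ _ => rfl
        have hy : ∀ d : Fin n → Fin 2, ∀ y : Fin n → Fin 2,
          regs d w y (Sum.inr (Sum.inr q)) = y q := fun _ _ => rfl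
        simp only [hd, hy, Function.update_self, Function.update_idem, h2, h3]
        congr 2
        · ext1 q'
          by_cases hqq : q' = q
          · subst hqq; simp [hq]
          · simp [hqq]
        · ext1 q'
          by_cases hqq : q' = q
          · subst hqq; simp [hq]
          · simp [hqq]
  obtain ⟨c, hc, hrun⟩ := key _ (List.nodup_finRange n)
  exact ⟨c, by simpa using hc, fun d w y => by simpa using hrun d w y⟩

theorem Holds.eq_regs {n p m : ℕ} {s : Fin n ⊕ (ℕ ⊕ Fin p) → Fin 2} (h : Holds s m) :
    s = regs (s ∘ Sum.inl) 0 0 := by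
  ext1 q
  rcases q with q | q | q
  · rfl
  · exact h.2 _
  · exact h.2 _

/-- Reversible implementation of a permutation for which straight-line programs compute the
permutation and its inverse. -/
theorem exists_permutation {n ℓ T T' : ℕ} {F F' : Set ((Fin n → Fin 2) → Fin 2)} (hℓ : ℓ ≤ 2 ^ n)
    (σ τ : Fin ℓ → Fin ℓ) (hστ : ∀ m, σ (τ m) = m) (hτσ : ∀ m, τ (σ m) = m)
    (h : SLP T F) (f : Fin n → (Fin n → Fin 2) → Fin 2) (hf : ∀ q, f q ∈ F)
    (hfσ : ∀ (m : Fin ℓ) q, f q (regBits n m) = regBits n (σ m) q)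
    (h' : SLP T' F') (g : Fin n → (Fin n → Fin 2) → Fin 2) (hg : ∀ q, g q ∈ F')
    (hgτ : ∀ (m : Fin ℓ) q, g q (regBits n m) = regBits n (τ m) q) :
    ∃ c : List (Gate (Fin n ⊕ (ℕ ⊕ Fin n))), Impl c (fun (x : Fin ℓ → ℂ) m => x (τ m)) ∧
      c.length ≤ 38 * T + 38 * T' + 5 * n := by
  obtain ⟨c₁, hc₁, hr₁⟩ := h.exists_xor f hf
  obtain ⟨c₂, hc₂, hr₂⟩ := exists_swapRegisters n
  obtain ⟨c₃, hc₃, hr₃⟩ := h'.exists_xor g hg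
  -- The registers run through `(m, 0)`, `(m, σ m)`, `(σ m, m)` and `(σ m, m + τ (σ m)) = (σ m, 0)`,
  -- with digitwise addition modulo `2`.
  refine ⟨c₁ ++ c₂ ++ c₃, impl_of_ket ⟨fun _ _ => rfl, fun _ _ => rfl⟩ hℓ ?_, ?_⟩
  · intro m s hs
    have h1 : (fun m' => (Pi.single m 1 : Fin ℓ → ℂ) (τ m')) = Pi.single (σ m) 1 := by
      ext m'
      simp only [Pi.single_apply]
      congr 1
      apply propext
      constructor
      · rintro rfl; exact (hστ m').symm
      · rintro rfl; exact hτσ m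
    have h2 : s ∘ Sum.inl = regBits n m := by rw [← hs.1, regBits_regVal]
    have h3 : (fun q => (0 : Fin n → Fin 2) q + f q (regBits n m)) = regBits n (σ m) := by
      ext1 q
      rw [Pi.zero_apply, zero_add, hfσ]
    have h4 : (fun q => regBits n m q + g q (regBits n (σ m))) = 0 := by
      have h5 : ∀ x : Fin 2, x + x = 0 := by decide
      ext1 q
      rw [hgτ, hτσ, h5]
      rfl
    have h6 : Holds (regs (p := n) (regBits n (σ m)) 0 0) (σ m) :=
      ⟨regVal_regBits ((σ m).2.trans_le hℓ), fun q => by rcases q with q | q <;> rfl⟩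
    rw [h1, enc_single h6, hs.eq_regs, h2, run_append, run_append, hr₁, h3, hr₂, hr₃, h4]
  · simp only [List.length_append]
    omega

/-! ### Modular addition by straight-line programs -/

/-- A binary digit of a number. -/
def bitAt (m i : ℕ) : Fin 2 := ⟨m / 2 ^ i % 2, Nat.mod_lt _ two_pos⟩

/-- The carry into digit `i` in the addition of `m` and `s`. -/
def carry (m s i : ℕ) : Fin 2 := if 2 ^ i ≤ m % 2 ^ i + s % 2 ^ i then 1 else 0

theorem bitAt_add (m s i : ℕ) : bitAt (m + s) i = bitAt m i + bitAt s i + carry m s i := by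
  apply Fin.ext
  simp only [bitAt, carry, Fin.val_add, Nat.add_div (pow_pos two_pos i)]
  split_ifs <;> simp

/-- The next carry is the majority of the two digits and the old carry, written as a polynomial
modulo `2`. -/
theorem carry_succ (m s i : ℕ) :
    carry m s (i + 1) = bitAt m i * carry m s i + bitAt s i * (bitAt m i + carry m s i) := by
  have hm := Nat.mod_lt m (pow_pos two_pos i)
  have hs := Nat.mod_lt s (pow_pos two_pos i)
  have h2 : ∀ x : ℕ, ∃ y : Fin 2, x % 2 = y := fun x => ⟨⟨x % 2, Nat.mod_lt _ two_pos⟩, rfl⟩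
  obtain ⟨a, ha⟩ := h2 (m / 2 ^ i)
  obtain ⟨b, hb⟩ := h2 (s / 2 ^ i)
  have ha' : bitAt m i = a := Fin.ext ha
  have hb' : bitAt s i = b := Fin.ext hb
  rw [ha', hb', carry, carry, Nat.mod_pow_succ, Nat.mod_pow_succ, pow_succ, ha, hb]
  generalize m % 2 ^ i = u at *
  generalize s % 2 ^ i = v at *
  generalize 2 ^ i = P at *
  fin_cases a <;> fin_cases b <;> by_cases h : P ≤ u + v <;> simp only [h] <;>
    simp <;> omega

theorem regBits_apply (n m : ℕ) (q : Fin n) : regBits n m q = bitAt m q := rfl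

theorem apply_eq_bitAt {n : ℕ} (d : Fin n → Fin 2) (q : Fin n) : d q = bitAt (regVal d) q :=
  Fin.ext (apply_eq_regVal_div d q)

theorem bitAt_add_two_pow {n i : ℕ} (hi : i < n) (m : ℕ) : bitAt (m + 2 ^ n) i = bitAt m i := by
  apply Fin.ext
  obtain ⟨p, rfl⟩ : ∃ p, n = i + (p + 1) := ⟨n - i - 1, by omega⟩
  simp only [bitAt]
  rw [pow_add, Nat.add_mul_div_left _ _ (pow_pos two_pos i), pow_succ]
  omega

section
variable {n : ℕ}

theorem SLP.input_mem {T : ℕ} {F : Set ((Fin n → Fin 2) → Fin 2)} (h : SLP T F) (q : Fin n) :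
    (fun d => d q) ∈ F := by
  induction h with
  | input => exact ⟨q, rfl⟩
  | const _ _ ih => exact Or.inr ih
  | add _ _ _ ih => exact Or.inr ih
  | mul _ _ _ ih => exact Or.inr ih

/-- A sequence of functions each of which costs at most `K` steps when the functions in `G` and
the preceding ones are available. -/
theorem SLP.exists_sequence {K : ℕ} (v : ℕ → (Fin n → Fin 2) → Fin 2)
    (G : Set ((Fin n → Fin 2) → Fin 2)) (p : ℕ)
    (hstep : ∀ i < p, ∀ T F, SLP T F → G ⊆ F → (∀ i' < i, v i' ∈ F) →
      ∃ T' F', T' ≤ T + K ∧ F ⊆ F' ∧ SLP T' F' ∧ v i ∈ F')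
    {T : ℕ} {F : Set ((Fin n → Fin 2) → Fin 2)} (h : SLP T F) (hG : G ⊆ F) :
    ∃ T' F', T' ≤ T + K * p ∧ F ⊆ F' ∧ SLP T' F' ∧ ∀ i < p, v i ∈ F' := by
  induction p with
  | zero => exact ⟨T, F, by omega, subset_rfl, h, by simp⟩
  | succ p ih =>
    obtain ⟨T₁, F₁, hT₁, hF₁, h₁, hv₁⟩ := ih fun i hi => hstep i (by omega)
    obtain ⟨T₂, F₂, hT₂, hF₂, h₂, hv₂⟩ := hstep p (by omega) T₁ F₁ h₁ (hG.trans hF₁) hv₁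
    refine ⟨T₂, F₂, by rw [Nat.mul_succ]; omega, hF₁.trans hF₂, h₂, fun i hi => ?_⟩
    rcases Nat.lt_succ_iff_lt_or_eq.1 hi with hi | rfl
    · exact hF₂ (hv₁ i hi)
    · exact hv₂

/-- The range includes the carry into digit `n`, the overflow that later decides about reduction
modulo the length. -/
theorem SLP.exists_carry (s : ℕ) {T : ℕ} {F : Set ((Fin n → Fin 2) → Fin 2)} (h : SLP T F) :
    ∃ T' F', T' ≤ T + 3 * (n + 1) ∧ F ⊆ F' ∧ SLP T' F' ∧
      ∀ i < n + 1, (fun d => carry (regVal d) s i) ∈ F' := by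
  refine SLP.exists_sequence _ ∅ (n + 1) ?_ h (Set.empty_subset _)
  intro i hi T F h _ hv
  rcases i with _ | i
  · refine ⟨_, _, ?_, ?_, h.const 0, ?_⟩
    · omega
    · exact Set.subset_insert _ _
    · refine Or.inl (funext fun d => ?_)
      simp [carry, Nat.mod_one]
  · have hc := hv i (by omega)
    have hd := h.input_mem ⟨i, by omega⟩
    -- The summand `s` is fixed, so its digits shape the program: one step for a digit `0`, three
    -- for a digit `1`.
    have hs : bitAt s i = 0 ∨ bitAt s i = 1 := by generalize bitAt s i = x; revert x; decide
    have hmul := h.mul hd hc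
    rcases hs with hs | hs
    · refine ⟨_, _, ?_, Set.subset_insert _ _, hmul, Or.inl (funext fun d => ?_)⟩
      · omega
      · rw [carry_succ, hs, zero_mul, add_zero, apply_eq_bitAt d ⟨i, by omega⟩]
    · have hadd := hmul.add (Or.inr hd) (Or.inr hc)
      have hsum := hadd.add (Or.inr (Or.inl rfl)) (Or.inl rfl)
      refine ⟨_, _, ?_, ?_, hsum, Or.inl (funext fun d => ?_)⟩
      · omega
      · exact fun f hf => Or.inr (Or.inr (Or.inr hf))
      · rw [carry_succ, hs, one_mul, apply_eq_bitAt d ⟨i, by omega⟩]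

/-- The condition that the `i` lowest digits of `m` vanish. -/
def lowZero (m i : ℕ) : Fin 2 := if m % 2 ^ i = 0 then 1 else 0

theorem lowZero_succ (m i : ℕ) : lowZero m (i + 1) = lowZero m i * (1 + bitAt m i) := by
  have h2 : m / 2 ^ i % 2 = 0 ∨ m / 2 ^ i % 2 = 1 := by omega
  rw [lowZero, lowZero, bitAt, Nat.mod_pow_succ]
  rcases h2 with h | h
  · simp [h]
  · simp [h]

theorem SLP.exists_lowZero {j : ℕ} (hj : j ≤ n) {T : ℕ} {F : Set ((Fin n → Fin 2) → Fin 2)}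
    (h : SLP T F) :
    ∃ T' F', T' ≤ T + 3 * (j + 1) ∧ F ⊆ F' ∧ SLP T' F' ∧
      ∀ i < j + 1, (fun d => lowZero (regVal d) i) ∈ F' := by
  refine SLP.exists_sequence _ ∅ (j + 1) ?_ h (Set.empty_subset _)
  intro i hi T F h _ hv
  rcases i with _ | i
  · refine ⟨_, _, ?_, ?_, h.const 1, ?_⟩
    · omega
    · exact Set.subset_insert _ _
    · refine Or.inl (funext fun d => ?_)
      simp [lowZero, Nat.mod_one]
  · have hc := hv i (by omega)
    have hd := h.input_mem ⟨i, by omega⟩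
    have hadd := (h.const 1).add (Or.inl rfl) (Or.inr hd)
    have hmul := hadd.mul (Or.inr (Or.inr hc)) (Or.inl rfl)
    refine ⟨_, _, ?_, ?_, hmul, Or.inl (funext fun d => ?_)⟩
    · omega
    · exact fun f hf => Or.inr (Or.inr (Or.inr hf))
    · rw [lowZero_succ, apply_eq_bitAt d ⟨i, by omega⟩]

/-- Addition of `s` modulo `ℓ` to the multiples of `2 ^ j`. -/
def condAdd (j ℓ s m : ℕ) : ℕ := if m % 2 ^ j = 0 then (m + s) % ℓ else m

/-- The digits of `condAdd`, from the carries of two additions. -/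
def condAddDigit (n j ℓ s m i : ℕ) : Fin 2 :=
  bitAt m i + lowZero m j * ((bitAt s i + carry m s i) + carry m (s + 2 ^ n - ℓ) n *
    ((bitAt s i + carry m s i) + (bitAt (s + 2 ^ n - ℓ) i + carry m (s + 2 ^ n - ℓ) i)))

/-- Put `s' = s + 2^n - ℓ`. Then `m + s'` overflows `n` digits exactly when `m + s ≥ ℓ`, and its low
digits are then those of `m + s - ℓ`. The overflow carry selects between the two sums as `A + carry
* (A + B)`, and `lowZero` switches the change on. -/
theorem condAddDigit_eq {n j ℓ s m i : ℕ} (hℓ : ℓ ≤ 2 ^ n) (hs : s < ℓ) (hm : m < ℓ) (hi : i < n) :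
    condAddDigit n j ℓ s m i = bitAt (condAdd j ℓ s m) i := by
  have h2 : ∀ a b c d : Fin 2, a + 1 * (b + 1 * (b + (c + d))) = a + c + d := by decide
  rw [condAddDigit, condAdd, lowZero]
  split_ifs with h
  · by_cases hc : ℓ ≤ m + s
    · have e1 : carry m (s + 2 ^ n - ℓ) n = 1 := by
        rw [carry, if_pos]
        rw [Nat.mod_eq_of_lt (by omega), Nat.mod_eq_of_lt (by omega)]
        omega
      have e2 : m + (s + 2 ^ n - ℓ) = (m + s) % ℓ + 2 ^ n := by
        rw [Nat.mod_eq_sub_mod hc, Nat.mod_eq_of_lt (by omega)]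
        omega
      rw [e1, h2, ← bitAt_add, e2, bitAt_add_two_pow hi]
    · have e1 : carry m (s + 2 ^ n - ℓ) n = 0 := by
        rw [carry, if_neg]
        rw [Nat.mod_eq_of_lt (by omega), Nat.mod_eq_of_lt (by omega)]
        omega
      rw [e1, Nat.mod_eq_of_lt (by omega), bitAt_add]
      simp [add_assoc]
  · simp

/-- Two carry chains and the flag take at most `9 * (n + 1)` steps, and each output digit takes nine
more. -/
theorem SLP.exists_condAddDigit {j : ℕ} (hj : j ≤ n) (ℓ s : ℕ) :
    ∃ T F, T ≤ 18 * n + 9 ∧ SLP T F ∧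
      ∀ i < n, (fun d : Fin n → Fin 2 => condAddDigit n j ℓ s (regVal d) i) ∈ F := by
  obtain ⟨T₁, F₁, hT₁, hF₁, h₁, hv₁⟩ := (SLP.input (n := n)).exists_carry s
  obtain ⟨T₂, F₂, hT₂, hF₂, h₂, hv₂⟩ := h₁.exists_carry (s + 2 ^ n - ℓ)
  obtain ⟨T₃, F₃, hT₃, hF₃, h₃, hv₃⟩ := h₂.exists_lowZero hj
  obtain ⟨T₄, F₄, hT₄, hF₄, h₄, hv₄⟩ := SLP.exists_sequence (K := 9)
    (fun i d => condAddDigit n j ℓ s (regVal d) i) F₃ n (by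
      intro i hi T F h hG _
      have hd := h.input_mem ⟨i, hi⟩
      have hc := hG (hF₃ (hF₂ (hv₁ i (by omega))))
      have hc' := hG (hF₃ (hv₂ i (by omega)))
      have hsel := hG (hF₃ (hv₂ n (by omega)))
      have hfl := hG (hv₃ j (by omega))
      -- Each `Or.inr` skips one function inserted later; `Or.inl rfl` is the latest one.
      have k1 := (h.const (bitAt s i)).add (Or.inl rfl) (Or.inr hc)
      have k2 := (k1.const (bitAt (s + 2 ^ n - ℓ) i)).add (Or.inl rfl)
        (Or.inr (Or.inr (Or.inr hc')))
      have k3 := k2.add (Or.inr (Or.inr (Or.inl rfl))) (Or.inl rfl)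
      have k4 := k3.mul (Or.inr (Or.inr (Or.inr (Or.inr (Or.inr hsel))))) (Or.inl rfl)
      have k5 := k4.add (Or.inr (Or.inr (Or.inr (Or.inr (Or.inl rfl))))) (Or.inl rfl)
      have k6 := k5.mul (Or.inr (Or.inr (Or.inr (Or.inr (Or.inr (Or.inr (Or.inr hfl)))))))
        (Or.inl rfl)
      have k7 := k6.add (Or.inr (Or.inr (Or.inr (Or.inr (Or.inr (Or.inr (Or.inr (Or.inr hd))))))))
        (Or.inl rfl)
      refine ⟨_, _, ?_, ?_, k7, Or.inl (funext fun d => ?_)⟩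
      · omega
      · exact fun f hf =>
          Or.inr (Or.inr (Or.inr (Or.inr (Or.inr (Or.inr (Or.inr (Or.inr (Or.inr hf))))))))
      · rw [condAddDigit, apply_eq_bitAt d ⟨i, hi⟩]) h₃ subset_rfl
  exact ⟨T₄, F₄, by omega, h₄, hv₄⟩

end

/-! ### Conditioned elementary steps -/

theorem run_controlled_ket {Q : Type} [DecidableEq Q] {c t : Q} (hct : c ≠ t)
    {U : Matrix (Fin 2) (Fin 2) ℂ} {l : List (Gate Q)}
    (hl : ∀ ψ b, run l ψ b =
      if b c = 1 then ∑ x, U (b t) x * ψ (Function.update b t x) else ψ b) (s : Q → Fin 2) :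
    run l (ket s) =
      if s c = 1 then ∑ x, U x (s t) • ket (Function.update s t x) else ket s := by
  ext b
  rw [hl]
  by_cases hb : ∀ p, p ≠ t → b p = s p
  · rw [hb c hct]
    split_ifs with h
    · have h1 : ∀ x, ket s (Function.update b t x) = if x = s t then 1 else 0 := by
        intro x
        split_ifs with hx
        · rw [show Function.update b t x = s from ?_, ket_self]
          ext1 p
          by_cases hp : p = t
          · subst hp; simp [hx]
          · rw [Function.update_of_ne hp, hb p hp]
        · refine ket_of_ne fun h' => hx ?_
          rw [← h', Function.update_self]
      have h2 : ∀ x, ket (Function.update s t x) b = if x = b t then 1 else 0 := by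
        intro x
        split_ifs with hx
        · rw [show b = Function.update s t x from ?_, ket_self]
          ext1 p
          by_cases hp : p = t
          · subst hp; simp [hx]
          · rw [Function.update_of_ne hp, hb p hp]
        · refine ket_of_ne fun h' => hx ?_
          rw [h', Function.update_self]
      simp [Finset.sum_apply, h1, h2]
    · rfl
  · have h1 : ∀ x, Function.update b t x ≠ s := by
      rintro x rfl
      exact hb fun p hp => (Function.update_of_ne hp _ _).symm
    have h2 : ∀ x, b ≠ Function.update s t x := by
      rintro x rfl
      exact hb fun p hp => Function.update_of_ne hp _ _
    have h3 : b ≠ s := by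
      rintro rfl
      exact hb fun _ _ => rfl
    split_ifs with h4 h5 h5
    · simp [Finset.sum_apply, ket_of_ne (h1 _), ket_of_ne (h2 _)]
    · simp [ket_of_ne (h1 _), ket_of_ne h3]
    · simp [Finset.sum_apply, ket_of_ne h3, ket_of_ne (h2 _)]
    · rfl

theorem position_mod (M : ℕ) {k : ℕ} (j : Fin k)
    (y : Fin (halfLength M k j * 2) × Fin (2 ^ (j : ℕ))) :
    (position M j y : ℕ) % 2 ^ (j : ℕ) = y.2 := by
  rw [position_val, Nat.add_mul_mod_self_left, Nat.mod_eq_of_lt y.2.2]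

/-- Translation of the subsequence with number `0`. -/
def condShift {M k : ℕ} (j : Fin k) (s : Fin (halfLength M k j * 2)) (m : Fin (M * 2 ^ k)) :
    Fin (M * 2 ^ k) :=
  if ((position M j).symm m).2.val = 0 then
    position M j (((position M j).symm m).1 + s, ((position M j).symm m).2)
  else m

theorem condShift_position {M k : ℕ} (j : Fin k) (s : Fin (halfLength M k j * 2))
    (y : Fin (halfLength M k j * 2) × Fin (2 ^ (j : ℕ))) :
    condShift j s (position M j y) =
      if y.2.val = 0 then position M j (y.1 + s, y.2) else position M j y := by
  simp [condShift]

/-- Shifting the subsequence by `s` adds `2^j * s`; reduction modulo the length commutes with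
scaling by `2^j`, because the length is `2^j` times that of the subsequence. -/
theorem condShift_val {M k : ℕ} (j : Fin k) (s : Fin (halfLength M k j * 2))
    (m : Fin (M * 2 ^ k)) :
    (condShift j s m : ℕ) = condAdd j (M * 2 ^ k) (2 ^ (j : ℕ) * s) m := by
  obtain ⟨⟨i, r⟩, rfl⟩ := (position M j).surjective m
  rw [condShift_position, condAdd, position_mod]
  split_ifs with h
  · simp only at h
    rw [position_val, position_val, ← halfLength_mul M j, h, zero_add, zero_add, ← mul_add,
      mul_comm _ (2 ^ (j : ℕ)), Nat.mul_mod_mul_left, Fin.val_add]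
  · rfl

theorem condShift_condShift {M k : ℕ} (j : Fin k) {s s' : Fin (halfLength M k j * 2)}
    (h : ∀ i, i + s' + s = i) (m : Fin (M * 2 ^ k)) : condShift j s (condShift j s' m) = m := by
  obtain ⟨⟨i, r⟩, rfl⟩ := (position M j).surjective m
  rw [condShift_position]
  split_ifs with hr
  · simp only at hr
    rw [condShift_position, if_pos hr, h]
  · rw [condShift_position, if_neg hr]

/-- A translation by `s` reads the signal at the index shifted back. The inverse `s'` is given by
equations, which make sense without `NeZero`. -/
theorem waveletStep_translationOp {M k : ℕ} (S : SplitFamily M k) (j : Fin k)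
    {s s' : Fin (halfLength M k j * 2)} (h : ∀ i, i + s' + s = i) (h' : ∀ i, i + s + s' = i)
    (hS : S j = translationOp s) :
    waveletStep S j = fun x m => x (condShift j s' m) := by
  ext x m
  obtain ⟨⟨i, r⟩, rfl⟩ := (position M j).surjective m
  rw [waveletStep_position, condShift_position]
  split_ifs with hr
  · have key : ∀ i', i = i' + s ↔ i' = i + s' := by
      intro i'
      constructor
      · rintro rfl; exact (h' i').symm
      · rintro rfl; exact (h i).symm
    simp [hS, Matrix.mulVec, dotProduct, translationOp, key]
  · rfl

section
variable {n M k : ℕ}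

theorem exists_waveletStep_translationOp (hM : 0 < M) (hn : M * 2 ^ k ≤ 2 ^ n) (S : SplitFamily M k)
    (j : Fin k) (hj : (j : ℕ) < n) (s : Fin (halfLength M k j * 2)) (hS : S j = translationOp s) :
    ∃ c : List (Gate (Fin n ⊕ (ℕ ⊕ Fin n))), Impl c (waveletStep S j) ∧ c.length ≤ 2100 * n := by
  have hpos : 0 < halfLength M k j * 2 := by
    have : 0 < halfLength M k j := Nat.mul_pos hM (pow_pos two_pos _)
    omega
  have : NeZero (halfLength M k j * 2) := ⟨hpos.ne'⟩
  have hs1 : ∀ i, i + -s + s = i := fun i => neg_add_cancel_right i s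
  have hs2 : ∀ i, i + s + -s = i := fun i => add_neg_cancel_right i s
  have hlt : ∀ s : Fin (halfLength M k j * 2), 2 ^ (j : ℕ) * (s : ℕ) < M * 2 ^ k := by
    intro s
    rw [← halfLength_mul M j, mul_comm _ (2 ^ (j : ℕ))]
    exact Nat.mul_lt_mul_of_pos_left s.2 (pow_pos two_pos _)
  obtain ⟨T, F, hT, h, hv⟩ :=
    SLP.exists_condAddDigit (n := n) hj.le (M * 2 ^ k) (2 ^ (j : ℕ) * (s : ℕ))
  obtain ⟨T', F', hT', h', hv'⟩ :=
    SLP.exists_condAddDigit (n := n) hj.le (M * 2 ^ k) (2 ^ (j : ℕ) * ((-s : Fin _) : ℕ))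
  have hdig : ∀ (s : Fin (halfLength M k j * 2)) (m : Fin (M * 2 ^ k)) (q : Fin n),
      condAddDigit n j (M * 2 ^ k) (2 ^ (j : ℕ) * (s : ℕ)) (regVal (regBits n m)) q =
        regBits n (condShift j s m) q := by
    intro s m q
    rw [regVal_regBits (m.2.trans_le hn), condAddDigit_eq hn (hlt s) m.2 q.2, regBits_apply,
      condShift_val]
  obtain ⟨c, hc, hlen⟩ := exists_permutation hn (condShift j s) (condShift j (-s))
    (condShift_condShift j hs1) (condShift_condShift j hs2)
    h (fun q d => condAddDigit n j (M * 2 ^ k) (2 ^ (j : ℕ) * (s : ℕ)) (regVal d) q)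
    (fun q => hv q q.2) (hdig s)
    h' (fun q d => condAddDigit n j (M * 2 ^ k) (2 ^ (j : ℕ) * ((-s : Fin _) : ℕ)) (regVal d) q)
    (fun q => hv' q q.2) (hdig (-s))
  -- Two programs with `18 * n + 9` steps give `76 * (18 * n + 9) + 5 * n ≤ 2057 * n`, as `j < n`
  -- forces `n ≥ 1`.
  refine ⟨c, ?_, by omega⟩
  rw [waveletStep_translationOp S j hs1 hs2 hS]
  exact hc

/-- The flag depends on the bits below `j` and the rotation changes only bit `j`, so a second run of
the flag circuit clears the flag in every branch of the superposition. -/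
theorem exists_waveletStep_localRotation (hn : M * 2 ^ k ≤ 2 ^ n) (S : SplitFamily M k)
    (j : Fin k) (hj : (j : ℕ) < n) (U : Matrix.unitaryGroup (Fin 2) ℂ)
    (hS : S j = localRotation (halfLength M k j) U) :
    ∃ c : List (Gate (Fin n ⊕ (ℕ ⊕ Fin n))), Impl c (waveletStep S j) ∧ c.length ≤ 2100 * n := by
  obtain ⟨T, F, hT, -, h, hv⟩ := (SLP.input (n := n)).exists_lowZero hj.le
  -- The flag goes to all `n` output qubits so that the ancillas have the same type as for
  -- translations; only output qubit `j` serves as control.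
  obtain ⟨c, hc, hrun⟩ := h.exists_xor (p := n) (fun _ d => lowZero (regVal d) j)
    (fun _ => hv j (by omega))
  obtain ⟨l, hl, hl'⟩ := exists_controlled
    (c := (Sum.inr (Sum.inr ⟨j, hj⟩) : Fin n ⊕ (ℕ ⊕ Fin n))) (t := Sum.inl ⟨j, hj⟩) (by simp) U
  refine ⟨c ++ l ++ c, impl_of_ket (waveletStep_isLinearMap S j) hn ?_, ?_⟩
  · intro m s hs
    have h2 : ∀ x : Fin 2, x + x = 0 := by decide
    have hrun0 : ∀ d : Fin n → Fin 2, run c (ket (regs d 0 (fun _ => lowZero (regVal d) j))) =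
        ket (regs d 0 0) := by
      intro d
      rw [hrun]
      simp only [h2]
      rfl
    have hlow : ∀ x, lowZero (regVal (Function.update (s ∘ Sum.inl) ⟨j, hj⟩ x)) j =
        lowZero (regVal (s ∘ Sum.inl)) j := by
      intro x
      have := regVal_update (s ∘ Sum.inl) ⟨j, hj⟩ x
      have h3 := congrArg (· % 2 ^ (j : ℕ)) this
      simp only [Nat.add_mul_mod_self_right] at h3
      rw [lowZero, lowZero, h3]
    rw [enc_waveletStep_localRotation S j hj U hS hs, run_append, run_append]
    conv_lhs => rw [hs.eq_regs, hrun]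
    simp only [Pi.zero_apply, zero_add]
    have hflag : regs (s ∘ Sum.inl) 0 (fun _ : Fin n => lowZero (regVal (s ∘ Sum.inl)) j)
        (Sum.inr (Sum.inr ⟨j, hj⟩)) = lowZero (regVal (s ∘ Sum.inl)) j := rfl
    have hbit : regs (s ∘ Sum.inl) 0 (fun _ : Fin n => lowZero (regVal (s ∘ Sum.inl)) j)
        (Sum.inl ⟨j, hj⟩) = s (Sum.inl ⟨j, hj⟩) := rfl
    rw [run_controlled_ket (by simp) hl', hflag, hbit, lowZero, hs.1]
    by_cases hm : (m : ℕ) % 2 ^ (j : ℕ) = 0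
    · rw [if_pos hm, if_pos rfl, if_pos hm, run_sum]
      refine Finset.sum_congr rfl fun x _ => ?_
      rw [run_smul, update_regs_data]
      congr 1
      have h4 := hrun0 (Function.update (s ∘ Sum.inl) ⟨j, hj⟩ x)
      rw [hlow, lowZero, hs.1, if_pos hm] at h4
      rw [h4, ← update_regs_data, ← hs.eq_regs]
    · have h4 := hrun0 (s ∘ Sum.inl)
      rw [lowZero, hs.1, if_neg hm] at h4
      rw [if_neg hm, if_neg (by decide), if_neg hm, h4, ← hs.eq_regs]
  · simp only [List.length_append]
    omega

end

/-! ### Products of elementary steps and sequences of levels -/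

section
variable {n M k : ℕ}

theorem waveletStep_mul {S S₁ S₂ : SplitFamily M k} {j : Fin k} (h : S j = S₁ j * S₂ j) :
    waveletStep S j = fun x => waveletStep S₁ j (waveletStep S₂ j x) := by
  ext x m
  obtain ⟨⟨i, r⟩, rfl⟩ := (position M j).surjective m
  simp only [waveletStep_position]
  split_ifs with hr
  · rw [h, ← Matrix.mulVec_mulVec]
  · rfl

theorem waveletStep_one {S : SplitFamily M k} {j : Fin k} (h : S j = 1) :
    waveletStep S j = id := by
  ext x m
  obtain ⟨⟨i, r⟩, rfl⟩ := (position M j).surjective m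
  rw [waveletStep_position, h, Matrix.one_mulVec]
  split_ifs <;> rfl

theorem exists_waveletStep_prod (hM : 0 < M) (hn : M * 2 ^ k ≤ 2 ^ n) (j : Fin k)
    (hj : (j : ℕ) < n)
    (l : List (Matrix (Fin (halfLength M k j * 2)) (Fin (halfLength M k j * 2)) ℂ))
    (hl : ∀ A ∈ l, IsElementaryStep A) (S : SplitFamily M k) (hS : S j = l.prod) :
    ∃ c : List (Gate (Fin n ⊕ (ℕ ⊕ Fin n))),
      Impl c (waveletStep S j) ∧ c.length ≤ 2100 * l.length * n := by
  induction l generalizing S with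
  | nil =>
    refine ⟨[], ?_, by simp⟩
    rw [waveletStep_one hS]
    exact Impl.nil
  | cons A l ih =>
    -- Updating the family at `j` lets a single factor serve as a splitting step. The product `A *
    -- l.prod` applies `l.prod` first, hence the order `c₂ ++ c₁`.
    obtain ⟨c₂, hc₂, hlen₂⟩ := ih (fun B hB => hl B (by simp [hB])) (Function.update S j l.prod)
      (Function.update_self _ _ _)
    have hA : Function.update S j A j = A := Function.update_self _ _ _
    obtain ⟨c₁, hc₁, hlen₁⟩ : ∃ c : List (Gate (Fin n ⊕ (ℕ ⊕ Fin n))),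
        Impl c (waveletStep (Function.update S j A) j) ∧ c.length ≤ 2100 * n := by
      rcases hl A (by simp) with ⟨U, hU⟩ | ⟨s, hs⟩
      · exact exists_waveletStep_localRotation hn _ j hj U (hA.trans hU)
      · exact exists_waveletStep_translationOp hM hn _ j hj s (hA.trans hs)
    refine ⟨c₂ ++ c₁, ?_, ?_⟩
    · rw [waveletStep_mul (S₁ := Function.update S j A) (S₂ := Function.update S j l.prod)
        (by rw [hA, Function.update_self, hS, List.prod_cons])]
      exact hc₂.append hc₁
    · rw [List.length_append, List.length_cons]
      nlinarith

theorem Impl.foldl {ℓ : ℕ} {A : Type} [DecidableEq A] {V : Fin k → (Fin ℓ → ℂ) → (Fin ℓ → ℂ)}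
    {c : Fin k → List (Gate (Fin n ⊕ A))} (h : ∀ j, Impl (c j) (V j)) (l : List (Fin k)) :
    Impl (l.flatMap c) (fun x => l.foldl (fun y j => V j y) x) := by
  induction l with
  | nil => exact Impl.nil
  | cons j l ih =>
    rw [List.flatMap_cons]
    exact (h j).append ih

theorem exists_foldl_circuit {ℓ : ℕ} {A : Type} [DecidableEq A]
    {V : Fin k → (Fin ℓ → ℂ) → (Fin ℓ → ℂ)} {c : Fin k → List (Gate (Fin n ⊕ A))}
    (h : ∀ j, Impl (c j) (V j)) :
    ∃ (a : ℕ) (c' : Circuit n a),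
      c'.Implements (fun x => (List.finRange k).foldl (fun y j => V j y) x) ∧
      c'.length = ∑ j, (c j).length := by
  obtain ⟨a, c', hc', hlen⟩ := (Impl.foldl h (List.finRange k)).exists_circuit
  refine ⟨a, c', hc', ?_⟩
  rw [hlen, List.length_flatMap, ← List.ofFn_eq_map, List.sum_ofFn]

/-! ### Unconditioned circuits and the comparison of costs -/

theorem exists_packetTransform_circuit (hk : k ≤ n) (S : SplitFamily M k) (a : Fin k → ℕ)
    (Q : ∀ j : Fin k, Circuit (n - j) (a j)) (hQ : ∀ j, (Q j).Implements fun x => S j *ᵥ x) :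
    ∃ (b : ℕ) (c : Circuit n b),
      c.Implements (packetTransform S) ∧ c.length = ∑ j, (Q j).length := by
  -- Every level returns its ancillas clean, so all levels share the ancillas `ℕ`.
  have h := fun j : Fin k => Impl.packetStep (n := n) (Fin.val_injective) S j (by omega)
    ((Circuit.implements_iff _ _).1 (hQ j))
  obtain ⟨b, c, hc, hlen⟩ := exists_foldl_circuit h
  exact ⟨b, c, hc, by simpa using hlen⟩

theorem exists_packetStep_circuit (hk : k ≤ n) (S : SplitFamily M k) (j : Fin k) {a : ℕ}
    (Q : Circuit (n - j) a) (hQ : Q.Implements fun x => S j *ᵥ x) :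
    ∃ (b : ℕ) (c : Circuit n b), c.Implements (packetStep S j) ∧ c.length = Q.length := by
  obtain ⟨b, c, hc, hlen⟩ := (Impl.packetStep (n := n) Function.injective_id S j (by omega)
    ((Circuit.implements_iff _ _).1 hQ)).exists_circuit
  exact ⟨b, c, hc, by simpa using hlen⟩

theorem localRotation_mulVec (N : ℕ) (U : Matrix.unitaryGroup (Fin 2) ℂ) (x : Fin (N * 2) → ℂ)
    (a : Fin N) (y : Fin 2) :
    (localRotation N U *ᵥ x) (finProdFinEquiv (a, y)) =
      ∑ y', U.1 y y' * x (finProdFinEquiv (a, y')) := by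
  rw [Matrix.mulVec, dotProduct, ← finProdFinEquiv.sum_comp, Fintype.sum_prod_type]
  simp only [localRotation_apply, ite_mul, zero_mul]
  rw [Finset.sum_eq_single a]
  · simp
  · intro b _ hb; simp [hb.symm]
  · simp

/-- The length `N * 2` is even, so changing qubit `0` never leaves the range of the signal. -/
theorem impl_localRotation {N p : ℕ} {A : Type} [DecidableEq A] (hp : 0 < p)
    (U : Matrix.unitaryGroup (Fin 2) ℂ) :
    Impl [(.single (Sum.inl ⟨0, hp⟩) U : Gate (Fin p ⊕ A))]
      (fun x => localRotation N U *ᵥ x) := by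
  intro x
  ext b
  rw [run_cons, run_nil, act_single]
  have hval : ∀ y, regVal (Function.update b (Sum.inl ⟨0, hp⟩) y ∘ Sum.inl) +
      b (Sum.inl ⟨0, hp⟩) = regVal (b ∘ Sum.inl) + y := by
    intro y
    rw [update_comp_inl]
    simpa using regVal_update (b ∘ Sum.inl) ⟨0, hp⟩ y
  have hbit : (b (Sum.inl ⟨0, hp⟩) : ℕ) = regVal (b ∘ Sum.inl) % 2 := by
    simpa using apply_eq_regVal_div (b ∘ Sum.inl) ⟨0, hp⟩
  by_cases h : regVal (b ∘ Sum.inl) < N * 2 ∧ ∀ q : A, b (Sum.inr q) = 0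
  · obtain ⟨⟨a, y⟩, hay⟩ := finProdFinEquiv.surjective (⟨_, h.1⟩ : Fin (N * 2))
    have hv : regVal (b ∘ Sum.inl) = y + 2 * a := by
      have := congrArg Fin.val hay
      simpa using this.symm
    have hy : b (Sum.inl ⟨0, hp⟩) = y := by
      apply Fin.ext
      omega
    rw [enc_of_eq _ ⟨_, h.1⟩ rfl h.2, ← hay]
    refine Eq.trans ?_ (localRotation_mulVec N U x a y).symm
    rw [hy]
    refine Finset.sum_congr rfl fun y' _ => ?_
    rw [enc_of_eq x (finProdFinEquiv (a, y'))]
    · have := hval y'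
      rw [hv, hy] at this
      simp only [finProdFinEquiv_apply_val]
      omega
    · intro q
      simpa using h.2 q
  · rw [enc_of_not _ h]
    refine Finset.sum_eq_zero fun y _ => ?_
    rw [enc_of_not, mul_zero]
    rintro ⟨h1, h2⟩
    refine h ⟨?_, fun q => by simpa using h2 q⟩
    have := hval y
    omega

/-- For a nonscalar rotation with `j ≥ 1` the circuit is one gate, while `W` has at least two.
Otherwise it is `W` itself with the low data qubits read as ancillas. -/
theorem exists_splitting_circuit (hM : 0 < M) (hk : k ≤ n)
    (S : SplitFamily M k) (j : Fin k) {a : ℕ} (W : Circuit n a)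
    (hW : W.Implements (waveletStep S j)) :
    ∃ (b : ℕ) (Q : Circuit (n - j) b),
      (Q.Implements fun x => S j *ᵥ x) ∧ Q.length ≤ W.length ∧
      (0 < (j : ℕ) →
        (∃ U : Matrix.unitaryGroup (Fin 2) ℂ, (∀ z : ℂ, U.1 ≠ z • 1) ∧
          S j = localRotation (halfLength M k j) U) →
        Q.length < W.length) := by
  have hj : (j : ℕ) < n := by omega
  rw [Circuit.implements_iff] at hW
  by_cases h : 0 < (j : ℕ) ∧ ∃ U : Matrix.unitaryGroup (Fin 2) ℂ, (∀ z : ℂ, U.1 ≠ z • 1) ∧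
      S j = localRotation (halfLength M k j) U
  · obtain ⟨hj0, U, hU, hS⟩ := h
    have hlen : 1 < W.length := by
      by_contra hlen
      obtain ⟨z, hz⟩ := scalar_of_impl hM S j hj0 hj U hS hW (by omega)
      exact hU z hz
    obtain ⟨b, Q, hQ, hQlen⟩ := (impl_localRotation (N := halfLength M k j) (A := Fin 0)
      (Nat.sub_pos_of_lt hj) U).exists_circuit
    rw [List.length_singleton] at hQlen
    exact ⟨b, Q, by rw [hS]; exact hQ, by omega, fun _ _ => by omega⟩
  · obtain ⟨b, Q, hQ, hQlen⟩ := (Impl.of_waveletStep (p := n - j) S j (by omega) hW).exists_circuit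
    rw [List.length_map] at hQlen
    exact ⟨b, Q, hQ, hQlen.le, fun h1 h2 => absurd ⟨h1, h2⟩ h⟩

end

/-! ### Assembly of the theorem -/

theorem mainTheorem2 :
    ∃ C : ℕ, ∀ (n k M L : ℕ), 0 < M → M * 2 ^ k ≤ 2 ^ n →
      ∀ (α β : ∀ j : Fin k, Fin (halfLength M k j * 2) → ℂ) (S : SplitFamily M k),
      (∀ j, IsQMF (α j) (β j)) →
      (∀ j, S j = splitMatrix (α j) (β j)) →
      (∀ j : Fin k, ∃ l : List (Matrix (Fin (halfLength M k j * 2)) (Fin (halfLength M k j * 2)) ℂ),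
        l.length = L ∧ (∀ A ∈ l, IsElementaryStep A) ∧ S j = l.prod) →
      -- at most `n` levels, each (conditioned or not) of cost at most `C * L * n`
      k ≤ n ∧
      (∀ j : Fin k, ∃ (a : ℕ) (c : Circuit n a),
        c.Implements (waveletStep S j) ∧ c.length ≤ C * L * n) ∧
      (∀ j : Fin k, ∃ (a : ℕ) (c : Circuit n a),
        c.Implements (packetStep S j) ∧ c.length ≤ C * L * n) ∧
      -- the transforms
      (∃ (a : ℕ) (c : Circuit n a),
        c.Implements (waveletTransform S) ∧ c.length ≤ C * L * n ^ 2) ∧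
      (∃ (a : ℕ) (c : Circuit n a),
        c.Implements (packetTransform S) ∧ c.length ≤ C * L * n ^ 2) ∧
      -- the packet transform runs splitting circuits unconditioned, without additional gates
      (∀ (a : Fin k → ℕ) (Q : ∀ j : Fin k, Circuit (n - j) (a j)),
        (∀ j, (Q j).Implements fun x => S j *ᵥ x) →
        ∃ (b : ℕ) (c : Circuit n b),
          c.Implements (packetTransform S) ∧ c.length = ∑ j, (Q j).length) ∧
      -- a conditioned splitting circuit never costs less than an unconditioned one
      (∀ (j : Fin k) (a : ℕ) (W : Circuit n a), W.Implements (waveletStep S j) →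
        ∃ (b : ℕ) (Q : Circuit (n - j) b),
          (Q.Implements fun x => S j *ᵥ x) ∧ Q.length ≤ W.length ∧
          (0 < (j : ℕ) →
            (∃ U : Matrix.unitaryGroup (Fin 2) ℂ, (∀ z : ℂ, U.1 ≠ z • 1) ∧
              S j = localRotation (halfLength M k j) U) →
            Q.length < W.length)) ∧
      -- hence the packet transform needs no more gates than the wavelet transform
      (∀ (a : Fin k → ℕ) (W : ∀ j : Fin k, Circuit n (a j)),
        (∀ j, (W j).Implements (waveletStep S j)) →
        ∃ (b : ℕ) (c : Circuit n b),
          c.Implements (packetTransform S) ∧ c.length ≤ ∑ j, (W j).length ∧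
          ((∃ j : Fin k, 0 < (j : ℕ) ∧
            ∃ U : Matrix.unitaryGroup (Fin 2) ℂ, (∀ z : ℂ, U.1 ≠ z • 1) ∧
              S j = localRotation (halfLength M k j) U) →
            c.length < ∑ j, (W j).length)) := by
  refine ⟨2100, fun n k M L hM hn α β S _ _ hl => ?_⟩
  have hk : k ≤ n := by
    refine (Nat.pow_le_pow_iff_right (by norm_num : 1 < 2)).1 (le_trans ?_ hn)
    exact Nat.le_mul_of_pos_left _ hM
  have hsum : ∀ f : Fin k → ℕ, (∀ j, f j ≤ 2100 * L * n) → ∑ j, f j ≤ 2100 * L * n ^ 2 := by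
    intro f hf
    calc ∑ j, f j ≤ ∑ _j : Fin k, 2100 * L * n := Finset.sum_le_sum fun j _ => hf j
      _ = k * (2100 * L * n) := by simp
      _ ≤ n * (2100 * L * n) := Nat.mul_le_mul_right _ hk
      _ = 2100 * L * n ^ 2 := by ring
  have hwave : ∀ j : Fin k, ∃ c : List (Gate (Fin n ⊕ (ℕ ⊕ Fin n))),
      Impl c (waveletStep S j) ∧ c.length ≤ 2100 * L * n := by
    intro j
    obtain ⟨l, rfl, hel, hprod⟩ := hl j
    exact exists_waveletStep_prod hM hn j (j.2.trans_le hk) l hel S hprod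
  choose cw hcw hcwlen using hwave
  choose aW W hW hWlen using fun j => (hcw j).exists_circuit
  have hsplit := fun (j : Fin k) (a : ℕ) (W : Circuit n a) =>
    exists_splitting_circuit hM hk S j W
  -- The packet bounds are inherited from the conditioned circuits by dropping the condition.
  choose aQ Q hQ hQlen _ using fun j => hsplit j _ (W j) (hW j)
  have hQn : ∀ j, (Q j).length ≤ 2100 * L * n := fun j =>
    (hQlen j).trans ((hWlen j).le.trans (hcwlen j))
  refine ⟨hk, ?_, ?_, ?_, ?_, ?_, hsplit, ?_⟩
  · exact fun j => ⟨aW j, W j, hW j, (hWlen j).le.trans (hcwlen j)⟩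
  · intro j
    obtain ⟨b, c, hc, hlen⟩ := exists_packetStep_circuit hk S j (Q j) (hQ j)
    exact ⟨b, c, hc, hlen.le.trans (hQn j)⟩
  · obtain ⟨b, c, hc, hlen⟩ := exists_foldl_circuit hcw
    exact ⟨b, c, hc, hlen.le.trans (hsum _ hcwlen)⟩
  · obtain ⟨b, c, hc, hlen⟩ := exists_packetTransform_circuit hk S aQ Q hQ
    exact ⟨b, c, hc, hlen.le.trans (hsum _ hQn)⟩
  · exact exists_packetTransform_circuit hk S
  · intro a W hW
    choose b Q hQ hQlen hQlt using fun j => hsplit j _ (W j) (hW j)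
    obtain ⟨b', c, hc, hlen⟩ := exists_packetTransform_circuit hk S b Q hQ
    refine ⟨b', c, hc, hlen.le.trans (Finset.sum_le_sum fun j _ => hQlen j), ?_⟩
    rintro ⟨j, hj, hU⟩
    rw [hlen]
    exact Finset.sum_lt_sum (fun j _ => hQlen j) ⟨j, Finset.mem_univ j, hQlt j hj hU⟩
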